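/- For $E\subset\mathbb C$, a weight $w:E\to[0,\infty)$ and $n\ge 2$, let $$\delta_n^w(E)=\sup_{z_1,\dots,z_n\in E}\Big(\prod_{1\le j<k\le n}|z_j-z_k|\,w(z_j)\,w(z_k)\Big)^{\frac{2}{n(n-1)}};$$ a set of $n$ points of $E$ attaining this supremum is called an $n$th weighted Fekete point set of $E$. Write $(t)_n=t(t+1)\cdots(t+n-1)$, $\binom{t}{k}=t(t-1)\cdots(t-k+1)/k!$, and for $\alpha,\beta\in\mathbb C$ let $$P_n^{(\alpha,\beta)}(x)=2^{-n}\sum_{k=0}^n\binom{n+\alpha}{n-k}\binom{n+\beta}{k}(x-1)^k(x+1)^{n-k}$$ be the Jacobi polynomial. **Theorem 1.2.** Let $a>0$, $s>1$, $n\ge 2$ and $w(x)=|x-ai|^{-s}$. Then the $n$th weighted Fekete point set of $\mathbb R$ for $w$ exists, is unique, and is the set of (complex) roots of $$G(x)=x^n+\sum_{k=1}^{\lfloor n/2\rfloor}\left((-1)^k a^{2k}\binom{n}{2k}\frac{(2k-1)!!}{\prod_{j=1}^k\big(2s(n-1)-2n+2j+1\big)}\right)x^{n-2k}.$$ Moreover,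 for all $x\in\mathbb C$, $$G(x)=\frac{(2ai)^n\,n!}{(n-2s(n-1)-1)_n}\,P_n^{(-s(n-1)-1,\,-s(n-1)-1)}(-ix/a),$$ and the supremum defining $\delta_n^w(\mathbb R)$ is finite and equals $$\delta_n^w(\mathbb R)=\frac{(2a)^{1-2s}(n!)^{2/n}}{\big|(-s(n-1))_n\big|^{2s/n}}\,\big|(n-2s(n-1)-1)_n\big|^{2(s-1)/n}\,\left|\prod_{k=1}^n k^{k-2n+2}\,(k-s(n-1)-1)^{2k-2}\,(n+k-2s(n-1)-2)^{n-k}\right|^{\frac{1}{n(n-1)}}.$$ -/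

import Mathlib

open Polynomial

noncomputable section

namespace WeightedFekete

/-- The weighted Vandermonde functional
`(∏_{j<k} |z_j - z_k| w(z_j) w(z_k)) ^ (2 / (n (n - 1)))` of an `n`-tuple of points. -/
def weightedVandermonde (n : ℕ) (w : ℂ → ℝ) (z : Fin n → ℂ) : ℝ :=
  (∏ k : Fin n, ∏ j ∈ Finset.Iio k, ‖z j - z k‖ * w (z j) * w (z k)) ^
    (2 / ((n : ℝ) * ((n : ℝ) - 1)))

/-- The set of values of the weighted Vandermonde functional on the `n`-tuples of points of `E`. -/
def vandermondeValues (n : ℕ) (w : ℂ → ℝ) (E : Set ℂ) : Set ℝ :=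
  {v | ∃ z : Fin n → ℂ, (∀ k, z k ∈ E) ∧ v = weightedVandermonde n w z}

/-- The `n`th weighted diameter `δ_n^w(E)`, the supremum of the weighted Vandermonde functional
over all `n`-tuples of points of `E` (meaningful when these values are bounded above). -/
def weightedDiameter (n : ℕ) (w : ℂ → ℝ) (E : Set ℂ) : ℝ :=
  sSup (vandermondeValues n w E)

/-- `F` is an `n`th weighted Fekete point set of `E`: it consists of `n` points of `E` at which
the weighted Vandermonde functional attains its maximum over all `n`-tuples of points of `E`. -/
def IsWeightedFeketeSet (n : ℕ) (w : ℂ → ℝ) (E F : Set ℂ) : Prop :=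
  ∃ z : Fin n → ℂ, Function.Injective z ∧ Set.range z = F ∧ (∀ k, z k ∈ E) ∧
    ∀ y : Fin n → ℂ, (∀ k, y k ∈ E) → weightedVandermonde n w y ≤ weightedVandermonde n w z

/-- The real line as a subset of `ℂ`. -/
def realLine : Set ℂ := Set.range ((↑) : ℝ → ℂ)

/-- The weight `w(x) = |x - a i| ^ (-s)`. -/
def weight (a s : ℝ) (x : ℂ) : ℝ := ‖x - a * Complex.I‖ ^ (-s)

/-- The Pochhammer symbol (rising factorial) `(t)_n = t (t + 1) ⋯ (t + n - 1)`. -/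
def poch {R : Type*} [CommRing R] (t : R) (n : ℕ) : R := (ascPochhammer R n).eval t

/-- The Jacobi polynomial
`P_n^{(α,β)}(x) = 2⁻ⁿ ∑_{k=0}^n C(n+α, n-k) C(n+β, k) (x-1)^k (x+1)^{n-k}` with arbitrary complex
parameters; `Ring.choose` is the generalized binomial coefficient. -/
def jacobi (n : ℕ) (α β : ℂ) : ℂ[X] :=
  C ((2 : ℂ) ^ n)⁻¹ * ∑ k ∈ Finset.range (n + 1),
    C (Ring.choose ((n : ℂ) + α) (n - k) * Ring.choose ((n : ℂ) + β) k) *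
      (X - 1) ^ k * (X + 1) ^ (n - k)

/-- The monic polynomial
`G(x) = x^n + ∑_{k=1}^{⌊n/2⌋} (-1)^k a^{2k} C(n,2k) (2k-1)!! / ∏_{j=1}^k (2s(n-1)-2n+2j+1) x^{n-2k}`.
-/
def feketePoly (a s : ℝ) (n : ℕ) : ℝ[X] :=
  X ^ n + ∑ k ∈ Finset.Icc 1 (n / 2),
    C ((-1) ^ k * a ^ (2 * k) * (n.choose (2 * k) : ℝ) *
      (((2 * k - 1).doubleFactorial : ℝ) /
        ∏ j ∈ Finset.Icc 1 k, (2 * s * ((n : ℝ) - 1) - 2 * n + 2 * j + 1))) * X ^ (n - 2 * k)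

/-- The closed form of the weighted diameter. The Pochhammer symbols and the product may be
negative, so the real powers are taken of their absolute values. -/
def diameterFormula (a s : ℝ) (n : ℕ) : ℝ :=
  (2 * a) ^ (1 - 2 * s) * (n.factorial : ℝ) ^ (2 / (n : ℝ)) /
      |poch (-s * ((n : ℝ) - 1)) n| ^ (2 * s / (n : ℝ)) *
    |poch ((n : ℝ) - 2 * s * ((n : ℝ) - 1) - 1) n| ^ (2 * (s - 1) / (n : ℝ)) *
    |∏ k ∈ Finset.Icc 1 n, (k : ℝ) ^ ((k : ℤ) - 2 * (n : ℤ) + 2) *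
        ((k : ℝ) - s * ((n : ℝ) - 1) - 1) ^ (2 * k - 2) *
        ((n : ℝ) + k - 2 * s * ((n : ℝ) - 1) - 2) ^ (n - k)| ^ (1 / ((n : ℝ) * ((n : ℝ) - 1)))

end WeightedFekete

end

/-!
On tuples of real points the weighted Vandermonde product tends to zero when a point tends to
infinity, since `|u - v| ≤ |u - a i| |v - a i| / a` and `s > 1`; hence it has a maximum
(`exists_forall_pairProd_le`). At a maximizing tuple `x` the partial derivatives vanish (Stieltjes'
electrostatic argument), which says that for `Q = ∏ (X - x_j)` the polynomial
`(X² + a²) Q'' - t X Q' + n (t - n + 1) Q`, with `t = 2 s (n - 1)`, vanishes at all the `x_j`. Its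
degree is less than `n`, so it is zero, having `n` distinct roots. The differential equation has a single monic solution of
degree `n`, because `t > 2 n - 2` (`eq_of_odeOp_eq_zero`), and `feketePoly` is a solution. So every
maximizing tuple consists of the roots of `feketePoly` (`prod_X_sub_C_eq_feketePoly`), which gives
uniqueness. The ultraspherical Jacobi polynomial satisfies the same equation with `a² = -1`, and
comparing leading coefficients, by the Chu-Vandermonde identity, gives the relation between the two
(`aeval_feketePoly_eq_jacobi`).

The square of the maximal product is the discriminant of `feketePoly` times a power of its value at
`a i`, and that value is read off from the Jacobi polynomial at `1`. The discriminant is computed by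
Schur's method. With `t` fixed, the solutions `p_m` of degree `m ≤ n` satisfy a three-term
recurrence, which determines the resultant of `p_m` and `p_{m-1}` (`rootProd_ultraC_succ`), and a
relation `(X² + a²) p_m' = m X p_m + d p_{m-1}`, which turns this resultant into the discriminant
(`rootProd_derivative_ultraC`). The resulting product is brought to the closed form by induction on
the degree (`lowerCoeff_pow_mul_prod_recCoeff`).
-/

namespace WeightedFekete

/-! ### The differential equation and `feketePoly` -/

/-- The differential operator `p ↦ (X² + b) p'' - t X p' + n (t - n + 1) p`. Its last coefficient is
chosen so that a polynomial of degree `n` is sent to one of degree less than `n`. -/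
noncomputable def odeOp {K : Type*} [Field K] (b t : K) (n : ℕ) (p : K[X]) : K[X] :=
  (X ^ 2 + C b) * derivative (derivative p) - C t * X * derivative p +
    C ((n : K) * (t - n + 1)) * p

section Operator

variable {K : Type*} [Field K] (b t : K) (n : ℕ)

theorem odeOp_add (p q : K[X]) : odeOp b t n (p + q) = odeOp b t n p + odeOp b t n q := by
  simp only [odeOp, derivative_add]; ring

theorem odeOp_C_mul (c : K) (p : K[X]) : odeOp b t n (C c * p) = C c * odeOp b t n p := by
  simp only [odeOp, derivative_C_mul]; ring

theorem odeOp_sub (p q : K[X]) : odeOp b t n (p - q) = odeOp b t n p - odeOp b t n q := by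
  simp only [odeOp, derivative_sub]; ring

theorem odeOp_map {L : Type*} [Field L] (f : K →+* L) (p : K[X]) :
    odeOp (f b) (f t) n (p.map f) = (odeOp b t n p).map f := by
  simp [odeOp, derivative_map]

theorem odeOp_comp_C_mul_X (c : K) (p : K[X]) :
    odeOp b t n (p.comp (C c * X)) = (odeOp (b * c ^ 2) t n p).comp (C c * X) := by
  simp [odeOp, derivative_comp]
  ring

theorem odeOp_X_pow (j : ℕ) :
    odeOp b t n (X ^ j) = C (((n : K) - j) * (t - n - j + 1)) * X ^ j +
      C (b * j * (j - 1)) * X ^ (j - 2) := by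
  rcases j with _ | _ | j
  · simp [odeOp]
  · simp [odeOp]; ring
  · simp [odeOp]; ring

theorem coeff_odeOp (p : K[X]) (m : ℕ) :
    (odeOp b t n p).coeff m =
      ((n : K) - m) * (t - n - m + 1) * p.coeff m + b * (m + 2) * (m + 1) * p.coeff (m + 2) := by
  have e : ((n : K) - m) * (t - n - m + 1) = n * (t - n + 1) - t * m + m * (m - 1) := by ring
  rw [e, odeOp]
  generalize (n : K) * (t - n + 1) = c
  rcases m with _ | _ | m
  · simp [add_mul, mul_assoc, coeff_derivative]; ring
  · simp [add_mul, mul_assoc, coeff_X_pow_mul', coeff_derivative, coeff_X_mul]; ring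
  · simp [add_mul, mul_assoc, coeff_X_pow_mul', coeff_derivative, coeff_X_mul]; ring

theorem natDegree_odeOp_le {p : K[X]} (hp : p.natDegree ≤ n) : (odeOp b t n p).natDegree ≤ n := by
  refine natDegree_le_iff_coeff_eq_zero.2 fun m hm => ?_
  rw [coeff_odeOp, coeff_eq_zero_of_natDegree_lt (hp.trans_lt hm),
    coeff_eq_zero_of_natDegree_lt (hp.trans_lt (by omega))]
  simp

/-- A polynomial solution of degree at most `n` of the differential equation is determined by its
coefficient of degree `n`: the leading coefficient of a solution of degree `m < n` is killed by
`(n - m) (t - n - m + 1)`. -/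
theorem eq_of_odeOp_eq_zero [CharZero K] {b t : K} {n : ℕ} (ht : ∀ m < n, t - n - m + 1 ≠ 0)
    {p q : K[X]} (hp : p.natDegree ≤ n) (hq : q.natDegree ≤ n) (hop : odeOp b t n p = 0)
    (hoq : odeOp b t n q = 0) (h : p.coeff n = q.coeff n) : p = q := by
  rw [← sub_eq_zero]
  by_contra hne
  set r := p - q with hr
  have hrn : r.natDegree ≤ n := (natDegree_sub_le _ _).trans (max_le hp hq)
  have hrc : r.coeff n = 0 := by simp [hr, h]
  have hlc : r.coeff r.natDegree ≠ 0 := by simpa using hne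
  have hlt : r.natDegree < n := lt_of_le_of_ne hrn fun h' => hlc (by rw [h', hrc])
  have h0 : odeOp b t n r = 0 := by rw [hr, odeOp_sub, hop, hoq, sub_zero]
  have hc := coeff_odeOp b t n r r.natDegree
  rw [h0, coeff_eq_zero_of_natDegree_lt (show r.natDegree < r.natDegree + 2 by omega)] at hc
  have h1 : ((n : K) - r.natDegree) ≠ 0 := sub_ne_zero.2 (by exact_mod_cast hlt.ne')
  have h2 := ht _ hlt
  simp only [coeff_zero, mul_zero, add_zero] at hc
  exact mul_ne_zero (mul_ne_zero h1 h2) hlc hc.symm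

end Operator

section FeketePoly

/-- The coefficient of `x ^ (n - 2 k)` in `feketePoly a s n`. -/
noncomputable def feketeCoeff (a s : ℝ) (n k : ℕ) : ℝ :=
  (-1) ^ k * a ^ (2 * k) * (n.choose (2 * k) : ℝ) *
    (((2 * k - 1).doubleFactorial : ℝ) /
      ∏ j ∈ Finset.Icc 1 k, (2 * s * ((n : ℝ) - 1) - 2 * n + 2 * j + 1))

theorem feketePoly_eq_sum (a s : ℝ) (n : ℕ) :
    feketePoly a s n =
      ∑ k ∈ Finset.range (n / 2 + 1), C (feketeCoeff a s n k) * X ^ (n - 2 * k) := by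
  rw [Finset.sum_range_succ']
  have h0 : C (feketeCoeff a s n 0) * X ^ (n - 2 * 0) = (X ^ n : ℝ[X]) := by
    simp [feketeCoeff]
  rw [h0, feketePoly, add_comm]
  congr 1
  rw [Finset.range_eq_Ico, Finset.sum_Ico_add' (fun k => C (feketeCoeff a s n k) * X ^ (n - 2 * k))]
  rfl

theorem feketePoly_monic (a s : ℝ) (n : ℕ) : (feketePoly a s n).Monic := by
  refine monic_X_pow_add ?_
  refine (degree_sum_le _ _).trans_lt ?_
  rw [Finset.sup_lt_iff (by exact WithBot.bot_lt_coe n)]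
  intro k hk
  rw [Finset.mem_Icc] at hk
  refine (degree_C_mul_X_pow_le _ _).trans_lt ?_
  exact_mod_cast (show n - 2 * k < n by omega)

theorem feketePoly_natDegree (a s : ℝ) (n : ℕ) : (feketePoly a s n).natDegree = n := by
  refine le_antisymm ?_ ?_
  · rw [feketePoly_eq_sum]
    refine natDegree_sum_le_of_forall_le _ _ fun k _ => ?_
    exact (natDegree_C_mul_X_pow_le _ _).trans (Nat.sub_le _ _)
  · refine le_natDegree_of_ne_zero ?_
    rw [feketePoly, coeff_add, coeff_X_pow_self, finsetSum_coeff, Finset.sum_eq_zero]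
    · simp
    · intro k hk
      rw [Finset.mem_Icc] at hk
      rw [coeff_C_mul, coeff_X_pow, if_neg (by omega), mul_zero]

/-- The denominators in `feketePoly` do not vanish. -/
theorem feketeDenom_pos {s : ℝ} {n : ℕ} (hs : 1 < s) (hn : 2 ≤ n) {j : ℕ} (hj : 1 ≤ j) :
    0 < 2 * s * ((n : ℝ) - 1) - 2 * n + 2 * j + 1 := by
  have h1 : (2 : ℝ) ≤ n := by exact_mod_cast hn
  have h2 : (1 : ℝ) ≤ j := by exact_mod_cast hj
  nlinarith

theorem feketeCoeff_succ {a s : ℝ} {n k : ℕ} (hs : 1 < s) (hn : 2 ≤ n) (hk : 2 * k ≤ n) :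
    feketeCoeff a s n (k + 1) * (2 * (k + 1)) * (2 * s * ((n : ℝ) - 1) - 2 * n + 2 * (k + 1) + 1) =
      -(a ^ 2 * (n - 2 * k) * (n - 2 * k - 1) * feketeCoeff a s n k) := by
  have hd := (feketeDenom_pos (s := s) hs hn (j := k + 1) (by omega)).ne'
  have hP : ∏ j ∈ Finset.Icc 1 k, (2 * s * ((n : ℝ) - 1) - 2 * n + 2 * j + 1) ≠ 0 :=
    Finset.prod_ne_zero_iff.2 fun j hj => (feketeDenom_pos hs hn (Finset.mem_Icc.1 hj).1).ne'
  have hf : ((2 * (k + 1) - 1).doubleFactorial : ℝ) =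
      (2 * k + 1) * ((2 * k - 1).doubleFactorial : ℝ) := by
    rcases k with _ | k
    · simp
    · rw [show 2 * (k + 1 + 1) - 1 = (2 * (k + 1) - 1) + 2 by omega, Nat.doubleFactorial_add_two]
      rw [show 2 * (k + 1) - 1 + 2 = 2 * (k + 1) + 1 by omega]
      push_cast
      ring
  have hc : (n.choose (2 * (k + 1)) : ℝ) * ((2 * k + 2) * (2 * k + 1)) =
      n.choose (2 * k) * ((n - 2 * k) * (n - 2 * k - 1)) := by
    have e1 := Nat.choose_succ_right_eq n (2 * k)
    have e2 := Nat.choose_succ_right_eq n (2 * k + 1)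
    have e1' : (n.choose (2 * k + 1) : ℝ) * (2 * k + 1) = n.choose (2 * k) * (n - 2 * k) := by
      have := congrArg (Nat.cast (R := ℝ)) e1
      push_cast [Nat.cast_sub hk] at this
      exact this
    rcases hk.eq_or_lt with h | h
    · have hz : (n : ℝ) - 2 * k = 0 := by rw [← h]; push_cast; ring
      rw [Nat.choose_eq_zero_of_lt (by omega), hz]
      simp
    · have e2' : (n.choose (2 * k + 2) : ℝ) * (2 * k + 2) =
          n.choose (2 * k + 1) * (n - 2 * k - 1) := by
        have := congrArg (Nat.cast (R := ℝ)) e2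
        push_cast [Nat.cast_sub (show 2 * k + 1 ≤ n by omega)] at this
        linear_combination this
      rw [show 2 * (k + 1) = 2 * k + 2 by ring]
      linear_combination (2 * k + 1) * e2' + (n - 2 * k - 1) * e1'
  rw [feketeCoeff, feketeCoeff, Finset.prod_Icc_succ_top (by omega), hf]
  push_cast at hd ⊢
  generalize ∏ j ∈ Finset.Icc 1 k, (2 * s * ((n : ℝ) - 1) - 2 * n + 2 * j + 1) = P at hP ⊢
  generalize 2 * s * ((n : ℝ) - 1) - 2 * n + 2 * (k + 1) + 1 = D at hd ⊢
  generalize (n.choose (2 * (k + 1)) : ℝ) = c' at hc ⊢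
  field_simp
  linear_combination (-(1 : ℝ)) ^ k * (-1) * a ^ (2 * k + 2) * hc

/-- Applied to the partial sums of `feketePoly`, the differential operator telescopes. -/
theorem odeOp_feketePoly {a s : ℝ} {n : ℕ} (hs : 1 < s) (hn : 2 ≤ n) :
    odeOp (a ^ 2) (2 * s * ((n : ℝ) - 1)) n (feketePoly a s n) = 0 := by
  -- What is left of a partial sum is the lower-order term of its last monomial.
  have key : ∀ N, 2 * N ≤ n → odeOp (a ^ 2) (2 * s * ((n : ℝ) - 1)) n
      (∑ k ∈ Finset.range (N + 1), C (feketeCoeff a s n k) * X ^ (n - 2 * k)) =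
      C (a ^ 2 * (n - 2 * N) * (n - 2 * N - 1) * feketeCoeff a s n N) * X ^ (n - 2 * N - 2) := by
    intro N
    induction N with
    | zero =>
      intro _
      rw [zero_add, Finset.sum_range_one, odeOp_C_mul, odeOp_X_pow, mul_add,
        ← mul_assoc (C _) (C _), ← C_mul, ← mul_assoc (C _) (C _), ← C_mul]
      simp
      ring
    | succ N ih =>
      intro hN
      rw [Finset.sum_range_succ, odeOp_add, ih (by omega), odeOp_C_mul, odeOp_X_pow, mul_add,
        ← mul_assoc (C _) (C _), ← C_mul, ← mul_assoc (C _) (C _), ← C_mul, Nat.cast_sub hN,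
        show n - 2 * N - 2 = n - 2 * (N + 1) by omega, ← add_assoc, ← add_mul, ← C_add]
      have hz := feketeCoeff_succ (a := a) hs hn (show 2 * N ≤ n by omega)
      rw [show a ^ 2 * ((n : ℝ) - 2 * N) * (n - 2 * N - 1) * feketeCoeff a s n N +
        feketeCoeff a s n (N + 1) * (((n : ℝ) - (n - ((2 * (N + 1) : ℕ) : ℝ))) *
          (2 * s * (n - 1) - n - (n - ((2 * (N + 1) : ℕ) : ℝ)) + 1)) = 0 by
        push_cast
        linear_combination hz]
      rw [C_0, zero_mul, zero_add]
      congr 2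
      push_cast
      ring
  rw [feketePoly_eq_sum, key _ (by omega)]
  -- For `N = ⌊n / 2⌋` that term vanishes: `n - 2 N` is `0` or `1`.
  have : ((n : ℝ) - 2 * (n / 2 : ℕ)) * (n - 2 * (n / 2 : ℕ) - 1) = 0 := by
    rcases Nat.even_or_odd' n with ⟨m, hm | hm⟩
    · have : n / 2 = m := by omega
      rw [this, hm]; push_cast; ring
    · have : n / 2 = m := by omega
      rw [this, hm]; push_cast; ring
  rw [mul_assoc (a ^ 2), this]
  simp

end FeketePoly

/-! ### Jacobi polynomials -/

theorem choose_eq_descPochhammer_eval (r : ℂ) (n : ℕ) :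
    Ring.choose r n = (descPochhammer ℂ n).eval r / (n.factorial : ℂ) := by
  rw [Ring.choose_eq_smul, ← Polynomial.aeval_eq_smeval, aeval_def, eval₂_eq_eval_map,
    descPochhammer_map, smul_eq_mul]
  ring

theorem succ_mul_choose_succ (r : ℂ) (j : ℕ) :
    ((j : ℂ) + 1) * Ring.choose r (j + 1) = (r - j) * Ring.choose r j := by
  have h0 : (j.factorial : ℂ) ≠ 0 := by exact_mod_cast j.factorial_ne_zero
  have h1 : (j : ℂ) + 1 ≠ 0 := by exact_mod_cast j.succ_ne_zero
  rw [choose_eq_descPochhammer_eval, choose_eq_descPochhammer_eval, descPochhammer_succ_eval,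
    Nat.factorial_succ]
  push_cast
  field_simp

theorem choose_eq_poch (r : ℂ) (n : ℕ) :
    Ring.choose r n = poch (r - n + 1) n / (n.factorial : ℂ) := by
  rw [choose_eq_descPochhammer_eval, descPochhammer_eval_eq_ascPochhammer, poch]

/-- The operator with the Jacobi parameters on `(x - 1) ^ k (x + 1) ^ m`. The truncated exponents are
harmless, since they come with the factors `k` and `m`. -/
theorem odeOp_pow_mul_pow (α : ℂ) (k m : ℕ) :
    odeOp (-1) (-(2 * α + 2)) (k + m) ((X - 1) ^ k * (X + 1 : ℂ[X]) ^ m) =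
      C (2 * k * (k + α)) * ((X - 1) ^ (k - 1) * (X + 1 : ℂ[X]) ^ m) -
      C (2 * m * (m + α)) * ((X - 1) ^ k * (X + 1 : ℂ[X]) ^ (m - 1)) := by
  have hA : ∀ j : ℕ, (X - 1 : ℂ[X]) * ((j : ℂ[X]) * (X - 1 : ℂ[X]) ^ (j - 1)) =
      j * (X - 1 : ℂ[X]) ^ j := by
    intro j; cases j <;> simp [pow_succ]; ring
  have hB : ∀ j : ℕ, (X + 1 : ℂ[X]) * ((j : ℂ[X]) * (X + 1 : ℂ[X]) ^ (j - 1)) =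
      j * (X + 1 : ℂ[X]) ^ j := by
    intro j; cases j <;> simp [pow_succ]; ring
  have hA' : (X - 1 : ℂ[X]) * ((k : ℂ[X]) * (((k - 1 : ℕ) : ℂ[X]) * (X - 1 : ℂ[X]) ^ (k - 1 - 1))) =
      (k - 1) * (k * (X - 1 : ℂ[X]) ^ (k - 1)) := by
    rw [mul_left_comm, hA]
    cases k <;> simp; ring
  have hB' : (X + 1 : ℂ[X]) * ((m : ℂ[X]) * (((m - 1 : ℕ) : ℂ[X]) * (X + 1 : ℂ[X]) ^ (m - 1 - 1))) =
      (m - 1) * (m * (X + 1 : ℂ[X]) ^ (m - 1)) := by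
    rw [mul_left_comm, hB]
    cases m <;> simp; ring
  have d1 : ∀ j : ℕ, derivative ((X - 1 : ℂ[X]) ^ j) = j * (X - 1 : ℂ[X]) ^ (j - 1) := by
    intro j; simp [derivative_pow]
  have d2 : ∀ j : ℕ, derivative ((X + 1 : ℂ[X]) ^ j) = j * (X + 1 : ℂ[X]) ^ (j - 1) := by
    intro j; simp [derivative_pow]
  have c1 : (C 2 : ℂ[X]) = 2 := rfl
  simp only [odeOp, derivative_mul, derivative_add, d1, d2, derivative_natCast, C_mul, C_add, C_neg,
    C_sub, C_1, c1, Nat.cast_add, C_eq_natCast, zero_mul, zero_add]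
  have a1 := hA k
  have b1 := hB m
  generalize (X - 1 : ℂ[X]) ^ (k - 1 - 1) = u2 at *
  generalize (X - 1 : ℂ[X]) ^ (k - 1) = u1 at *
  generalize (X - 1 : ℂ[X]) ^ k = u0 at *
  generalize (X + 1 : ℂ[X]) ^ (m - 1 - 1) = v2 at *
  generalize (X + 1 : ℂ[X]) ^ (m - 1) = v1 at *
  generalize (X + 1 : ℂ[X]) ^ m = v0 at *
  linear_combination (X + 1) * v0 * hA' + (X - 1) * u0 * hB' +
    (2 * m * (X + 1) * v1 + (C α + 1) * v0 + (k + C α) * v0) * a1 +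
    (2 * k * u0 + (C α + 1) * u0 + (m + C α) * u0) * b1

/-- The coefficients of the Jacobi polynomial in the basis `(x - 1) ^ k (x + 1) ^ (n - k)`. -/
noncomputable def jacobiCoeff (n : ℕ) (α : ℂ) (k : ℕ) : ℂ :=
  Ring.choose ((n : ℂ) + α) (n - k) * Ring.choose ((n : ℂ) + α) k

theorem jacobiCoeff_succ {n k : ℕ} (α : ℂ) (hk : k < n) :
    jacobiCoeff n α (k + 1) * ((k + 1) * (k + 1 + α)) =
      jacobiCoeff n α k * ((n - k) * (n - k + α)) := by
  obtain ⟨m, rfl⟩ : ∃ m, n = k + 1 + m := ⟨n - (k + 1), by omega⟩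
  have h1 := succ_mul_choose_succ (((k + 1 + m : ℕ) : ℂ) + α) k
  have h2 := succ_mul_choose_succ (((k + 1 + m : ℕ) : ℂ) + α) m
  rw [jacobiCoeff, jacobiCoeff, show k + 1 + m - (k + 1) = m by omega,
    show k + 1 + m - k = m + 1 by omega]
  generalize Ring.choose (((k + 1 + m : ℕ) : ℂ) + α) (k + 1) = f1 at *
  generalize Ring.choose (((k + 1 + m : ℕ) : ℂ) + α) k = f0 at *
  generalize Ring.choose (((k + 1 + m : ℕ) : ℂ) + α) (m + 1) = g1 at *
  generalize Ring.choose (((k + 1 + m : ℕ) : ℂ) + α) m = g0 at *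
  push_cast at *
  linear_combination g0 * (k + 1 + α) * h1 - f0 * (m + 1 + α) * h2

/-- Applied to the defining sum of the ultraspherical Jacobi polynomial, the differential operator
telescopes. -/
theorem odeOp_jacobi (n : ℕ) (α : ℂ) : odeOp (-1) (-(2 * α + 2)) n (jacobi n α α) = 0 := by
  have hterm : ∀ k ≤ n, odeOp (-1) (-(2 * α + 2)) n
      (C (jacobiCoeff n α k) * (X - 1) ^ k * (X + 1) ^ (n - k)) =
      C (jacobiCoeff n α k * (2 * k * (k + α))) * ((X - 1) ^ (k - 1) * (X + 1) ^ (n - k)) -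
      C (jacobiCoeff n α k * (2 * (n - k) * (n - k + α))) *
        ((X - 1) ^ k * (X + 1) ^ (n - k - 1)) := by
    intro k hk
    have := odeOp_pow_mul_pow α k (n - k)
    rw [Nat.add_sub_cancel' hk, Nat.cast_sub hk] at this
    rw [mul_assoc, odeOp_C_mul, this, mul_sub, ← mul_assoc (C _) (C _), ← C_mul,
      ← mul_assoc (C _) (C _), ← C_mul]
  have key : ∀ N ≤ n, odeOp (-1) (-(2 * α + 2)) n
      (∑ k ∈ Finset.range N, C (jacobiCoeff n α k) * (X - 1) ^ k * (X + 1) ^ (n - k)) =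
      -(C (jacobiCoeff n α N * (2 * N * (N + α))) *
        ((X - 1) ^ (N - 1) * (X + 1) ^ (n - N))) := by
    intro N
    induction N with
    | zero => intro _; simp [odeOp]
    | succ N ih =>
      intro hN
      rw [Finset.sum_range_succ, odeOp_add, ih (by omega), hterm N (by omega)]
      have h := jacobiCoeff_succ α (show N < n by omega)
      rw [show jacobiCoeff n α (N + 1) * (2 * ((N + 1 : ℕ) : ℂ) * (((N + 1 : ℕ) : ℂ) + α)) =
          jacobiCoeff n α N * (2 * (n - N) * (n - N + α)) by
        push_cast; linear_combination 2 * h,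
        show N + 1 - 1 = N by omega, show n - (N + 1) = n - N - 1 by omega]
      ring
  have hj : jacobi n α α = C ((2 : ℂ) ^ n)⁻¹ * ∑ k ∈ Finset.range (n + 1),
    C (jacobiCoeff n α k) * (X - 1) ^ k * (X + 1) ^ (n - k) := rfl
  rw [hj, odeOp_C_mul, Finset.sum_range_succ, odeOp_add, key n le_rfl, hterm n le_rfl]
  simp

theorem natDegree_X_sub_one_pow_mul {n k : ℕ} (hk : k ≤ n) :
    ((X - 1 : ℂ[X]) ^ k * (X + 1) ^ (n - k)).natDegree = n := by
  have h1 : (X - 1 : ℂ[X]).Monic := by simpa using monic_X_sub_C (1 : ℂ)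
  have h2 : (X + 1 : ℂ[X]).Monic := by simpa using monic_X_add_C (1 : ℂ)
  have h3 : (X - 1 : ℂ[X]).natDegree = 1 := by simpa using natDegree_X_sub_C (1 : ℂ)
  have h4 : (X + 1 : ℂ[X]).natDegree = 1 := by simpa using natDegree_X_add_C (1 : ℂ)
  rw [(h1.pow k).natDegree_mul (h2.pow _), h1.natDegree_pow, h2.natDegree_pow, h3, h4]
  omega

theorem coeff_X_sub_one_pow_mul {n k : ℕ} (hk : k ≤ n) :
    ((X - 1 : ℂ[X]) ^ k * (X + 1) ^ (n - k)).coeff n = 1 := by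
  have h1 : (X - 1 : ℂ[X]).Monic := by simpa using monic_X_sub_C (1 : ℂ)
  have h2 : (X + 1 : ℂ[X]).Monic := by simpa using monic_X_add_C (1 : ℂ)
  have h := ((h1.pow k).mul (h2.pow (n - k))).coeff_natDegree
  rwa [natDegree_X_sub_one_pow_mul hk] at h

theorem natDegree_jacobi_le (n : ℕ) (α β : ℂ) : (jacobi n α β).natDegree ≤ n := by
  refine (natDegree_C_mul_le _ _).trans (natDegree_sum_le_of_forall_le _ _ fun k hk => ?_)
  rw [mul_assoc]
  refine (natDegree_C_mul_le _ _).trans (natDegree_X_sub_one_pow_mul ?_).le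
  exact Nat.lt_succ_iff.1 (Finset.mem_range.1 hk)

/-- The leading coefficient of the ultraspherical Jacobi polynomial, by the Chu-Vandermonde
identity. -/
theorem coeff_jacobi (n : ℕ) (α : ℂ) :
    (jacobi n α α).coeff n = poch (n + 2 * α + 1) n / (2 ^ n * n.factorial) := by
  have hV := Ring.add_choose_eq (r := (n : ℂ) + α) (s := (n : ℂ) + α) n (Commute.all _ _)
  rw [Finset.Nat.sum_antidiagonal_eq_sum_range_succ_mk, choose_eq_poch,
    show (n : ℂ) + α + (n + α) - n + 1 = n + 2 * α + 1 by ring] at hV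
  rw [jacobi, coeff_C_mul, finsetSum_coeff, Finset.sum_congr rfl (g := fun k =>
    Ring.choose ((n : ℂ) + α) k * Ring.choose ((n : ℂ) + α) (n - k)), ← hV]
  · field_simp
  · intro k hk
    rw [mul_assoc, coeff_C_mul, coeff_X_sub_one_pow_mul (Nat.lt_succ_iff.1 (Finset.mem_range.1 hk))]
    ring

theorem eval_one_jacobi (n : ℕ) (α β : ℂ) :
    (jacobi n α β).eval 1 = poch (α + 1) n / n.factorial := by
  rw [jacobi, eval_mul, eval_C, eval_finsetSum, Finset.sum_range_succ']
  simp [choose_eq_poch, one_add_one_eq_two]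
  field_simp

/-- `feketePoly` is a rescaled ultraspherical Jacobi polynomial: after the rescaling both solve the
same differential equation and they have the same leading coefficient. -/
theorem aeval_feketePoly_eq_jacobi {a s : ℝ} {n : ℕ} (ha : 0 < a) (hs : 1 < s) (hn : 2 ≤ n)
    (x : ℂ) : aeval x (feketePoly a s n) =
      (2 * a * Complex.I) ^ n * (n.factorial : ℂ) / poch ((n : ℂ) - 2 * s * ((n : ℂ) - 1) - 1) n *
        (jacobi n (-s * ((n : ℂ) - 1) - 1) (-s * ((n : ℂ) - 1) - 1)).eval
          (-Complex.I * x / a) := by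
  set α : ℂ := -s * ((n : ℂ) - 1) - 1 with hα
  set P : ℂ := poch ((n : ℂ) - 2 * s * ((n : ℂ) - 1) - 1) n with hP
  have haC : (a : ℂ) ≠ 0 := by exact_mod_cast ha.ne'
  have h2n : (2 : ℝ) ≤ n := by exact_mod_cast hn
  have hP0 : P ≠ 0 := by
    rw [hP, poch, Ne, ascPochhammer_eval_eq_zero_iff]
    rintro ⟨k, hk, he⟩
    have hk' : (k : ℝ) + 1 ≤ n := by exact_mod_cast hk
    have := congrArg Complex.re he
    simp at this
    nlinarith
  have hfac : (n.factorial : ℂ) ≠ 0 := by exact_mod_cast n.factorial_ne_zero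
  set c : ℂ := -Complex.I / a with hc
  have hc2 : ((a : ℂ)) ^ 2 * c ^ 2 = -1 := by
    rw [hc]; field_simp; simp
  set K : ℂ := (2 * a * Complex.I) ^ n * (n.factorial : ℂ) / P with hK
  have hmain : (feketePoly a s n).map (algebraMap ℝ ℂ) =
      C K * (jacobi n α α).comp (C c * X) := by
    refine eq_of_odeOp_eq_zero (b := (a : ℂ) ^ 2) (t := 2 * s * ((n : ℂ) - 1)) (n := n) ?_ ?_ ?_ ?_
      ?_ ?_
    · intro m hm he
      have hm' : (m : ℝ) + 1 ≤ n := by exact_mod_cast hm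
      have := congrArg Complex.re he
      simp at this
      nlinarith
    · rw [natDegree_map, feketePoly_natDegree]
    · refine (natDegree_C_mul_le _ _).trans (natDegree_comp_le.trans ?_)
      calc _ ≤ n * 1 := Nat.mul_le_mul (natDegree_jacobi_le _ _ _)
            ((natDegree_C_mul_le _ _).trans natDegree_X.le)
        _ = n := mul_one n
    · have := odeOp_map (a ^ 2) (2 * s * ((n : ℝ) - 1)) n (algebraMap ℝ ℂ) (feketePoly a s n)
      rw [odeOp_feketePoly hs hn] at this
      simpa using this
    · rw [odeOp_C_mul, odeOp_comp_C_mul_X, hc2,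
        show 2 * (s : ℂ) * ((n : ℂ) - 1) = -(2 * α + 2) by rw [hα]; ring, odeOp_jacobi]
      simp
    · rw [coeff_map, coeff_C_mul, comp_C_mul_X_coeff, coeff_jacobi,
        show (n : ℂ) + 2 * α + 1 = (n : ℂ) - 2 * s * ((n : ℂ) - 1) - 1 by rw [hα]; ring, ← hP]
      have h1 := (feketePoly_monic a s n).coeff_natDegree
      rw [feketePoly_natDegree] at h1
      rw [h1, hK, hc, map_one]
      have hI : (2 * (a : ℂ) * Complex.I) ^ n * (-Complex.I / a) ^ n = 2 ^ n := by
        rw [← mul_pow]; congr 1; field_simp; simp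
      field_simp
      rw [← hI]
      ring
  rw [aeval_def, ← eval_map, hmain, eval_mul, eval_C, eval_comp, eval_mul, eval_C, eval_X, hc]
  congr 2
  ring

/-- The value of `feketePoly` at `a i`. -/
theorem norm_aeval_feketePoly_mul_I {a s : ℝ} {n : ℕ} (ha : 0 < a) (hs : 1 < s) (hn : 2 ≤ n) :
    ‖aeval ((a : ℂ) * Complex.I) (feketePoly a s n)‖ =
      (2 * a) ^ n * |poch (-s * ((n : ℝ) - 1)) n| /
        |poch ((n : ℝ) - 2 * s * ((n : ℝ) - 1) - 1) n| := by
  have haC : (a : ℂ) ≠ 0 := by exact_mod_cast ha.ne'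
  have hfac : (n.factorial : ℂ) ≠ 0 := by exact_mod_cast n.factorial_ne_zero
  have hcast : ∀ r : ℝ, poch (r : ℂ) n = ((poch r n : ℝ) : ℂ) := by
    intro r
    have := ascPochhammer_eval₂ Complex.ofRealHom n r
    exact this.trans (eval₂_hom Complex.ofRealHom r)
  rw [aeval_feketePoly_eq_jacobi ha hs hn,
    show -Complex.I * ((a : ℂ) * Complex.I) / a = 1 by
      field_simp; simp, eval_one_jacobi,
    show -(s : ℂ) * ((n : ℂ) - 1) - 1 + 1 = ((-s * ((n : ℝ) - 1) : ℝ) : ℂ) by push_cast; ring,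
    show (n : ℂ) - 2 * s * ((n : ℂ) - 1) - 1 = ((n - 2 * s * ((n : ℝ) - 1) - 1 : ℝ) : ℂ) by
      push_cast; ring, hcast, hcast]
  have : |a| = a := abs_of_pos ha
  simp [this]
  field_simp

/-! ### Ladder relations and resultants -/

/-- The lowering coefficient `d` in `(X² + b) p_{m+1}' = (m + 1) X p_{m+1} + d p_m`, where the `p_m`
are the polynomials `ultra b t m`. -/
noncomputable def lowerCoeff (b t : ℝ) (m : ℕ) : ℝ :=
  b * (m + 1) * (t - m + 1) / (t - 2 * m + 1)

/-- The coefficient of the three-term recurrence defining `ultra b t`. -/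
noncomputable def recCoeff (b t : ℝ) (m : ℕ) : ℝ :=
  lowerCoeff b t m / (t - 2 * m - 1)

/-- The monic polynomials obtained from the ultraspherical recurrence with a fixed parameter `t`;
the one of degree `n` solves `odeOp b t n p = 0`, and `feketePoly` is one of them. -/
noncomputable def ultra (b t : ℝ) : ℕ → ℝ[X]
  | 0 => 1
  | 1 => X
  | m + 2 => X * ultra b t (m + 1) - C (recCoeff b t m) * ultra b t m

theorem ultra_succ_succ (b t : ℝ) (m : ℕ) :
    ultra b t (m + 2) = X * ultra b t (m + 1) - C (recCoeff b t m) * ultra b t m := rfl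

theorem ultra_monic_natDegree (b t : ℝ) (m : ℕ) :
    (ultra b t m).Monic ∧ (ultra b t m).natDegree = m := by
  induction m using Nat.twoStepInduction with
  | zero => exact ⟨monic_one, natDegree_one⟩
  | one => exact ⟨monic_X, natDegree_X⟩
  | more m ih₀ ih₁ =>
    have hX : (X * ultra b t (m + 1)).Monic := monic_X.mul ih₁.1
    have hXd : (X * ultra b t (m + 1)).natDegree = m + 2 := by
      rw [monic_X.natDegree_mul ih₁.1, ih₁.2, natDegree_X]; ring
    have hlt : (C (recCoeff b t m) * ultra b t m).degree < (X * ultra b t (m + 1)).degree := by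
      rw [degree_eq_natDegree hX.ne_zero, hXd]
      refine (degree_le_natDegree.trans (WithBot.coe_le_coe.2 (natDegree_C_mul_le _ _))).trans_lt ?_
      rw [ih₀.2]
      exact WithBot.coe_lt_coe.2 (Nat.lt_add_of_pos_right two_pos)
    rw [ultra_succ_succ]
    exact ⟨hX.sub_of_left hlt, by
      rw [natDegree_eq_of_degree_eq (degree_sub_eq_left_of_degree_lt hlt), hXd]⟩

/-- The two ladder relations, which propagate together along the three-term recurrence. -/
theorem ultra_ladder {b t : ℝ} {m : ℕ} (ht : (2 * m : ℝ) - 1 < t) :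
    (X ^ 2 + C b) * derivative (ultra b t (m + 1)) =
        C ((m : ℝ) + 1) * X * ultra b t (m + 1) + C (lowerCoeff b t m) * ultra b t m ∧
      (X ^ 2 + C b) * derivative (ultra b t m) =
        C (t - m + 1) * X * ultra b t m - C (t - 2 * m + 1) * ultra b t (m + 1) := by
  induction m with
  | zero =>
    have h1 : t + 1 ≠ 0 := by norm_num at ht; linarith
    constructor
    · simp [ultra, lowerCoeff, h1]; ring
    · simp [ultra]
  | succ m ih =>
    push_cast at ht
    obtain ⟨hL, hM⟩ := ih (by linarith)
    have h1 : t - 2 * m - 1 ≠ 0 := by linarith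
    have h2 : t - 2 * m + 1 ≠ 0 := by linarith
    have hd : lowerCoeff b t m = recCoeff b t m * (t - 2 * m - 1) := by
      rw [recCoeff, div_mul_cancel₀ _ h1]
    have hd' : lowerCoeff b t (m + 1) = b + recCoeff b t m * (t - 2 * m + 1) := by
      rw [recCoeff, lowerCoeff, lowerCoeff]
      push_cast
      rw [show t - 2 * ((m : ℝ) + 1) + 1 = t - 2 * m - 1 by ring, div_right_comm,
        div_mul_cancel₀ _ h2, div_eq_iff h1, add_mul, div_mul_cancel₀ _ h1]
      ring
    have c1 : (C 2 : ℝ[X]) = 2 := rfl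
    rw [hd] at hL
    constructor
    · rw [ultra_succ_succ, hd']
      simp only [derivative_sub, derivative_mul, derivative_X, derivative_C, C_add, C_sub, C_mul,
        C_1, c1, Nat.cast_add, Nat.cast_one] at hL hM ⊢
      linear_combination X * hL - C (recCoeff b t m) * hM
    · rw [hL, ultra_succ_succ]
      simp only [C_add, C_sub, C_mul, C_1, c1, Nat.cast_add, Nat.cast_one]
      ring

/-- Differentiating the lowering relation and eliminating `p_m` gives `X² + b` times the differential
equation. -/
theorem odeOp_ultra {b t : ℝ} {m : ℕ} (ht : (2 * m : ℝ) - 1 < t) :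
    odeOp b t (m + 1) (ultra b t (m + 1)) = 0 := by
  obtain ⟨hL, hM⟩ := ultra_ladder (b := b) ht
  have h2 : t - 2 * m + 1 ≠ 0 := by linarith
  have hd : lowerCoeff b t m * (t - 2 * m + 1) = b * (m + 1) * (t - m + 1) := by
    rw [lowerCoeff, div_mul_cancel₀ _ h2]
  have hd' := congrArg (C : ℝ → ℝ[X]) hd
  have hL' := congrArg derivative hL
  have hne : (X ^ 2 + C b : ℝ[X]) ≠ 0 := (monic_X_pow_add_C b two_ne_zero).ne_zero
  refine (mul_eq_zero.1 ?_).resolve_left hne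
  have c1 : (C 2 : ℝ[X]) = 2 := rfl
  simp only [odeOp, derivative_mul, derivative_add, derivative_X_pow, derivative_C, derivative_X,
    derivative_one,
    C_add, C_sub, C_mul, C_1, c1, Nat.cast_add, Nat.cast_one, Nat.cast_ofNat] at hL hM hL' hd' ⊢
  linear_combination (X ^ 2 + C b) * hL' + C (lowerCoeff b t m) * hM -
    (C t - C (m : ℝ) + 1) * X * hL - ultra b t (m + 1) * hd'

theorem feketePoly_eq_ultra {a s : ℝ} {n : ℕ} (hs : 1 < s) (hn : 2 ≤ n) :
    feketePoly a s n = ultra (a ^ 2) (2 * s * ((n : ℝ) - 1)) n := by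
  obtain ⟨m, rfl⟩ : ∃ m, n = m + 1 := ⟨n - 1, by omega⟩
  have hm : (1 : ℝ) ≤ m := by exact_mod_cast (by omega : 1 ≤ m)
  refine eq_of_odeOp_eq_zero (b := a ^ 2) (t := 2 * s * (((m + 1 : ℕ) : ℝ) - 1)) ?_
    (feketePoly_natDegree _ _ _).le (ultra_monic_natDegree _ _ _).2.le (odeOp_feketePoly hs hn)
    (odeOp_ultra ?_) ?_
  · intro j hj
    have hj' : (j : ℝ) ≤ m := by exact_mod_cast Nat.lt_succ_iff.1 hj
    push_cast
    apply ne_of_gt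
    nlinarith
  · push_cast
    nlinarith
  · have h1 := (feketePoly_monic a s (m + 1)).coeff_natDegree
    have h2 := (ultra_monic_natDegree (a ^ 2) (2 * s * (((m + 1 : ℕ) : ℝ) - 1))
      (m + 1)).1.coeff_natDegree
    rw [feketePoly_natDegree] at h1
    rw [(ultra_monic_natDegree _ _ _).2] at h2
    rw [h1, h2]

/-- The absolute value of the resultant of `p` and `q`, for monic `p`: the product of the `|q(z)|`
over the complex roots `z` of `p`, with multiplicity. -/
noncomputable def rootProd (p q : ℂ[X]) : ℝ := (p.roots.map fun z => ‖q.eval z‖).prod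

theorem norm_eval_eq_prod_roots {q : ℂ[X]} (hq : q.Monic) (z : ℂ) :
    ‖q.eval z‖ = (q.roots.map fun y => ‖z - y‖).prod := by
  conv_lhs => rw [(IsAlgClosed.splits q).eq_prod_roots_of_monic hq]
  rw [eval_multiset_prod, Multiset.map_map]
  simp only [Function.comp_def, eval_sub, eval_X, eval_C]
  exact (Multiset.prod_hom' q.roots (normHom : ℂ →*₀ ℝ) (fun y => z - y)).symm

theorem rootProd_comm {p q : ℂ[X]} (hp : p.Monic) (hq : q.Monic) :
    rootProd p q = rootProd q p := by
  simp only [rootProd, norm_eval_eq_prod_roots hp, norm_eval_eq_prod_roots hq]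
  rw [Multiset.prod_map_prod_map]
  simp only [norm_sub_rev]

theorem rootProd_mul (p q r : ℂ[X]) : rootProd p (q * r) = rootProd p q * rootProd p r := by
  simp [rootProd, Multiset.prod_map_mul]

theorem rootProd_C (p : ℂ[X]) (c : ℂ) : rootProd p (C c) = ‖c‖ ^ p.natDegree := by
  simp [rootProd, IsAlgClosed.card_roots_eq_natDegree]

theorem rootProd_congr {p q r : ℂ[X]} (h : ∀ z, p.eval z = 0 → ‖q.eval z‖ = ‖r.eval z‖) :
    rootProd p q = rootProd p r := by
  rw [rootProd, rootProd, Multiset.map_congr rfl]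
  exact fun z hz => h z (isRoot_of_mem_roots hz)

/-- `ultra b t m` as a complex polynomial. -/
noncomputable def ultraC (b t : ℝ) (m : ℕ) : ℂ[X] := (ultra b t m).map (algebraMap ℝ ℂ)

theorem ultraC_monic (b t : ℝ) (m : ℕ) : (ultraC b t m).Monic :=
  (ultra_monic_natDegree b t m).1.map _

theorem ultraC_natDegree (b t : ℝ) (m : ℕ) : (ultraC b t m).natDegree = m := by
  rw [ultraC, natDegree_map, (ultra_monic_natDegree b t m).2]

/-- The resultant of two consecutive polynomials: by the recurrence, `p_{m+2}` agrees with a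
multiple of `p_m` at the roots of `p_{m+1}`. -/
theorem rootProd_ultraC_succ (b t : ℝ) (m : ℕ) :
    rootProd (ultraC b t (m + 1)) (ultraC b t m) =
      ∏ i ∈ Finset.range m, |recCoeff b t i| ^ (i + 1) := by
  induction m with
  | zero => simp [rootProd, ultraC, ultra]
  | succ m ih =>
    rw [rootProd_comm (ultraC_monic _ _ _) (ultraC_monic _ _ _), rootProd_congr
      (r := C (recCoeff b t m : ℂ) * ultraC b t m), rootProd_mul, ih, rootProd_C,
      ultraC_natDegree, Finset.prod_range_succ, mul_comm]
    · simp
    · intro z hz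
      have : ultraC b t (m + 2) =
          X * ultraC b t (m + 1) - C (recCoeff b t m : ℂ) * ultraC b t m := by
        simp [ultraC, ultra_succ_succ]
      rw [this]
      simp [hz]

/-- Since `X² + a² = (X - a i) (X + a i)` and `p` is real, `p(a i)` and `p(-a i)` have the same
absolute value. -/
theorem rootProd_X_sq_add {p : ℝ[X]} (hp : p.Monic) (a : ℝ) :
    rootProd (p.map (algebraMap ℝ ℂ)) (X ^ 2 + C ((a ^ 2 : ℝ) : ℂ)) =
      ‖aeval ((a : ℂ) * Complex.I) p‖ ^ 2 := by
  have hf : (X ^ 2 + C ((a ^ 2 : ℝ) : ℂ) : ℂ[X]) =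
      (X - C ((a : ℂ) * Complex.I)) * (X - C (-((a : ℂ) * Complex.I))) := by
    have hI : (C Complex.I : ℂ[X]) ^ 2 = -1 := by
      rw [← C_pow, Complex.I_sq]; simp
    simp only [Complex.ofReal_pow, C_mul, C_neg, C_pow]
    linear_combination (C (a : ℂ)) ^ 2 * hI
  have hc : -((a : ℂ) * Complex.I) = (starRingEnd ℂ) ((a : ℂ) * Complex.I) := by simp
  have hm := hp.map (algebraMap ℝ ℂ)
  have h1 : ∀ c : ℂ, rootProd (p.map (algebraMap ℝ ℂ)) (X - C c) = ‖aeval c p‖ := by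
    intro c
    rw [rootProd_comm hm (monic_X_sub_C c), rootProd, roots_X_sub_C]
    simp [aeval_def, eval_map]
  rw [hf, rootProd_mul, h1, h1, hc, aeval_conj, RCLike.norm_conj, sq]

/-- The discriminant of `ultra` in absolute value, up to the value at `a i`: at the roots of
`p_{m+1}` the lowering relation expresses `p_{m+1}'` through `p_m`. -/
theorem rootProd_derivative_ultraC {a t : ℝ} {m : ℕ} (ht : (2 * m : ℝ) - 1 < t) :
    ‖aeval ((a : ℂ) * Complex.I) (ultra (a ^ 2) t (m + 1))‖ ^ 2 *
        rootProd (ultraC (a ^ 2) t (m + 1)) (derivative (ultraC (a ^ 2) t (m + 1))) =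
      |lowerCoeff (a ^ 2) t m| ^ (m + 1) *
        ∏ i ∈ Finset.range m, |recCoeff (a ^ 2) t i| ^ (i + 1) := by
  rw [← rootProd_ultraC_succ, ← rootProd_X_sq_add (ultra_monic_natDegree _ _ _).1, ← ultraC,
    ← rootProd_mul, rootProd_congr (r := C (lowerCoeff (a ^ 2) t m : ℂ) * ultraC (a ^ 2) t m),
    rootProd_mul, rootProd_C, ultraC_natDegree, Complex.norm_real, Real.norm_eq_abs]
  intro z hz
  have h := congrArg (Polynomial.map (algebraMap ℝ ℂ)) (ultra_ladder (b := a ^ 2) ht).1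
  simp only [Polynomial.map_mul, Polynomial.map_add, Polynomial.map_pow, map_X, map_C,
    ← derivative_map] at h
  rw [← ultraC, ← ultraC] at h
  have h' := congrArg (eval z) h
  simp only [eval_mul, eval_add, hz, mul_zero, zero_add] at h'
  simpa using congrArg norm h'

/-! ### The discriminant -/

theorem poch_eq_prod {R : Type*} [CommRing R] (r : R) (n : ℕ) :
    poch r n = ∏ j ∈ Finset.range n, (r + j) := by
  induction n with
  | zero => simp [poch]
  | succ n ih => rw [Finset.prod_range_succ, ← ih, poch, poch, ascPochhammer_succ_eval]

/-- The product formula for the right-hand side of `rootProd_derivative_ultraC`. -/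
theorem lowerCoeff_pow_mul_prod_recCoeff {a t : ℝ} {m : ℕ} (ht : (2 * m : ℝ) < t) :
    lowerCoeff (a ^ 2) t m ^ (m + 1) *
        (∏ i ∈ Finset.range m, recCoeff (a ^ 2) t i ^ (i + 1)) *
        (∏ j ∈ Finset.range (m + 1), (t - m - j)) ^ (2 * (m + 1)) =
      (2 * a) ^ ((m + 1) * (m + 2)) * (∏ k ∈ Finset.range (m + 1), ((k : ℝ) + 1) ^ (k + 1)) *
        (∏ k ∈ Finset.range (m + 1), (t / 2 - k) ^ (2 * (k + 1))) *
        ∏ k ∈ Finset.range (m + 1), (t - m - k) ^ (m - k) := by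
  induction m with
  | zero =>
    have h1 : t + 1 ≠ 0 := by norm_num at ht; linarith
    simp [lowerCoeff, h1]
    ring
  | succ m ih =>
    push_cast at ht
    have hD : t - 2 * m - 1 ≠ 0 := by linarith
    have hm : t - m ≠ 0 := by
      have : (0 : ℝ) ≤ m := m.cast_nonneg
      linarith
    have ih := ih (by linarith)
    -- `B` and `Q` are the parts that the products over `range (m + 1)` and `range (m + 2)` share.
    set B : ℝ := ∏ j ∈ Finset.range m, (t - m - 1 - j) with hB
    set Q : ℝ := ∏ k ∈ Finset.range m, (t - m - 1 - k) ^ (m - 1 - k) with hQ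
    have hA₀ : ∏ j ∈ Finset.range (m + 1), (t - m - j) = (t - m) * B := by
      rw [Finset.prod_range_succ', hB, mul_comm]
      push_cast
      simp only [sub_zero, sub_sub, add_comm, add_left_comm]
    have hA₁ : ∏ j ∈ Finset.range (m + 1 + 1), (t - ((m + 1 : ℕ) : ℝ) - j) =
        B * (t - 2 * m - 1) * (t - 2 * m - 2) := by
      rw [Finset.prod_range_succ, Finset.prod_range_succ, hB]
      push_cast
      simp only [sub_sub]
      ring
    have hW₀ : ∏ k ∈ Finset.range (m + 1), (t - m - k) ^ (m - k) = (t - m) ^ m * Q := by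
      rw [Finset.prod_range_succ', hQ, mul_comm]
      congr 1
      · simp
      · refine Finset.prod_congr rfl fun k _ => ?_
        rw [show m - 1 - k = m - (k + 1) by omega]
        push_cast
        ring
    have hW₁ : ∏ k ∈ Finset.range (m + 1 + 1), (t - ((m + 1 : ℕ) : ℝ) - k) ^ (m + 1 - k) =
        Q * B ^ 2 * (t - 2 * m - 1) := by
      rw [Finset.prod_range_succ, Finset.prod_range_succ, hB, hQ, ← Finset.prod_pow,
        ← Finset.prod_mul_distrib]
      simp only [Nat.sub_self, pow_zero, mul_one, Nat.add_sub_cancel_left, pow_one]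
      congr 1
      · refine Finset.prod_congr rfl fun k hk => ?_
        have := Finset.mem_range.1 hk
        rw [← pow_add, show m - 1 - k + 2 = m + 1 - k by omega]
        push_cast
        ring
      · push_cast; ring
    have hc : recCoeff (a ^ 2) t m = lowerCoeff (a ^ 2) t m / (t - 2 * m - 1) := rfl
    have hd : lowerCoeff (a ^ 2) t (m + 1) = a ^ 2 * (m + 2) * (t - m) / (t - 2 * m - 1) := by
      rw [lowerCoeff]; push_cast; congr 1 <;> ring
    rw [hA₀, hW₀] at ih
    rw [hA₁, hW₁, hd, Finset.prod_range_succ, hc,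
      Finset.prod_range_succ (fun k : ℕ => ((k : ℝ) + 1) ^ (k + 1)),
      Finset.prod_range_succ (fun k : ℕ => (t / 2 - k) ^ (2 * (k + 1)))]
    generalize (∏ k ∈ Finset.range (m + 1), ((k : ℝ) + 1) ^ (k + 1)) = R₁ at *
    generalize (∏ k ∈ Finset.range (m + 1), (t / 2 - k) ^ (2 * (k + 1))) = R₂ at *
    generalize (∏ i ∈ Finset.range m, recCoeff (a ^ 2) t i ^ (i + 1)) = S at *
    generalize lowerCoeff (a ^ 2) t m = d at *
    have ih' : d ^ (m + 1) * S * B ^ (2 * (m + 1)) * (t - m) ^ (m + 2) =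
        (2 * a) ^ ((m + 1) * (m + 2)) * R₁ * R₂ * Q := by
      refine mul_right_cancel₀ (pow_ne_zero m hm) ?_
      rw [mul_pow] at ih
      linear_combination ih
    have hhalf : t / 2 - ((m + 1 : ℕ) : ℝ) = (t - 2 * m - 2) / 2 := by push_cast; ring
    rw [hhalf]
    push_cast
    have e1 : (2 * a) ^ ((m + 1 + 1) * (m + 1 + 2)) =
        (2 * a) ^ ((m + 1) * (m + 2)) * (2 * a) ^ (2 * (m + 2)) := by
      rw [← pow_add]; congr 1; ring
    rw [e1]
    generalize (2 * a) ^ ((m + 1) * (m + 2)) = Z at *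
    have e2 : (2 * a) ^ (2 * (m + 2)) * ((t - 2 * m - 2) / 2) ^ (2 * (m + 1 + 1)) =
        (a ^ 2) ^ (m + 2) * (t - 2 * m - 2) ^ (2 * (m + 2)) := by
      rw [show 2 * (m + 1 + 1) = 2 * (m + 2) by ring, ← mul_pow, ← pow_mul a, ← mul_pow]
      congr 1; ring
    clear_value B Q
    clear hA₀ hA₁ hW₀ hW₁ hd hhalf hc
    generalize t - 2 * (m : ℝ) - 2 = v at *
    generalize t - 2 * (m : ℝ) - 1 = D at *
    generalize t - (m : ℝ) = u at *
    calc _ = (d ^ (m + 1) * S * B ^ (2 * (m + 1)) * u ^ (m + 2)) *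
          ((a ^ 2) ^ (m + 2) * v ^ (2 * (m + 2))) * (m + 2) ^ (m + 2) * B ^ 2 * D := by
          rw [div_pow, div_pow, mul_pow, mul_pow, mul_pow, mul_pow]
          have : D ^ (2 * (m + 1 + 1)) = D ^ (m + 1 + 1) * D ^ (m + 1) * D := by
            rw [← pow_add, ← pow_succ]; congr 1; ring
          rw [this]
          field_simp
          ring
      _ = _ := by
          rw [ih', ← e2]
          ring

/-- The discriminant of `feketePoly`, in absolute value. -/
theorem rootProd_derivative_feketePoly {a s : ℝ} {n : ℕ} (ha : 0 < a) (hs : 1 < s) (hn : 2 ≤ n) :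
    rootProd ((feketePoly a s n).map (algebraMap ℝ ℂ))
        (derivative ((feketePoly a s n).map (algebraMap ℝ ℂ))) =
      (2 * a) ^ (n * (n - 1)) * (n.factorial : ℝ) ^ (2 * (n - 1)) *
        |∏ k ∈ Finset.Icc 1 n, (k : ℝ) ^ ((k : ℤ) - 2 * (n : ℤ) + 2) *
          ((k : ℝ) - s * ((n : ℝ) - 1) - 1) ^ (2 * k - 2) *
          ((n : ℝ) + k - 2 * s * ((n : ℝ) - 1) - 2) ^ (n - k)| /
        |poch ((n : ℝ) - 2 * s * ((n : ℝ) - 1) - 1) n| ^ (2 * (n - 1)) := by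
  obtain ⟨m, rfl⟩ : ∃ m, n = m + 1 := ⟨n - 1, by omega⟩
  have hm : (1 : ℝ) ≤ m := by exact_mod_cast (by omega : 1 ≤ m)
  have hg := norm_aeval_feketePoly_mul_I ha hs hn
  rw [feketePoly_eq_ultra hs hn] at hg ⊢
  rw [show ((m + 1 : ℕ) : ℝ) - 1 = m by push_cast; ring] at hg ⊢
  set t : ℝ := 2 * s * m with ht_def
  have ht : (2 * m : ℝ) < t := by nlinarith
  have hD := rootProd_derivative_ultraC (a := a) (show (2 * m : ℝ) - 1 < t by linarith)
  have hF := lowerCoeff_pow_mul_prod_recCoeff (a := a) ht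
  have hjm : ∀ j ∈ Finset.range (m + 1), (j : ℝ) ≤ m := fun j hj => by
    exact_mod_cast Nat.lt_succ_iff.1 (Finset.mem_range.1 hj)
  have hA : |poch (((m + 1 : ℕ) : ℝ) - t - 1) (m + 1)| =
      ∏ j ∈ Finset.range (m + 1), (t - m - j) := by
    rw [poch_eq_prod, Finset.abs_prod]
    refine Finset.prod_congr rfl fun j hj => ?_
    have := hjm j hj
    rw [abs_of_neg (by push_cast; linarith)]
    push_cast
    ring
  have hA0 : 0 < ∏ j ∈ Finset.range (m + 1), (t - m - j) :=
    Finset.prod_pos fun j hj => by have := hjm j hj; linarith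
  have hB : |poch (-s * m) (m + 1)| = ∏ j ∈ Finset.range (m + 1), (t / 2 - j) := by
    rw [poch_eq_prod, Finset.abs_prod]
    refine Finset.prod_congr rfl fun j hj => ?_
    have := hjm j hj
    rw [abs_of_neg (by nlinarith)]
    rw [ht_def]
    ring
  have hB0 : 0 < ∏ j ∈ Finset.range (m + 1), (t / 2 - j) :=
    Finset.prod_pos fun j hj => by have := hjm j hj; linarith
  have hfac : ((m + 1).factorial : ℝ) = ∏ k ∈ Finset.range (m + 1), ((k : ℝ) + 1) := by
    rw [← Finset.prod_range_add_one_eq_factorial]; push_cast; rfl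
  -- The factorials cancel the exponents `-2 m`, and the factors `t / 2 - k` complete the powers, so
  -- that the two closed forms agree factor by factor.
  have hP : ((m + 1).factorial : ℝ) ^ (2 * m) *
      |∏ k ∈ Finset.Icc 1 (m + 1), (k : ℝ) ^ ((k : ℤ) - 2 * ((m + 1 : ℕ) : ℤ) + 2) *
        ((k : ℝ) - s * m - 1) ^ (2 * k - 2) *
        (((m + 1 : ℕ) : ℝ) + k - t - 2) ^ (m + 1 - k)| *
      (∏ j ∈ Finset.range (m + 1), (t / 2 - j)) ^ 2 =
      (∏ k ∈ Finset.range (m + 1), ((k : ℝ) + 1) ^ (k + 1)) *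
        (∏ k ∈ Finset.range (m + 1), (t / 2 - k) ^ (2 * (k + 1))) *
        ∏ k ∈ Finset.range (m + 1), (t - m - k) ^ (m - k) := by
    have hI : Finset.Icc 1 (m + 1) = Finset.Ico (0 + 1) (m + 1 + 1) := rfl
    rw [hI, ← Finset.prod_Ico_add', ← Finset.range_eq_Ico, hfac, Finset.abs_prod,
      ← Finset.prod_pow, ← Finset.prod_pow, ← Finset.prod_mul_distrib, ← Finset.prod_mul_distrib,
      ← Finset.prod_mul_distrib, ← Finset.prod_mul_distrib]
    refine Finset.prod_congr rfl fun k hk => ?_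
    have hk' := hjm k hk
    have h1 : (0 : ℝ) < (k : ℝ) + 1 := by positivity
    have h3 : ((m + 1 : ℕ) : ℝ) + ((k + 1 : ℕ) : ℝ) - t - 2 = -(t - m - k) := by push_cast; ring
    have h2 : ((k + 1 : ℕ) : ℝ) - s * m - 1 = -(t / 2 - k) := by rw [ht_def]; push_cast; ring
    rw [h2, h3, abs_mul, abs_mul, abs_zpow, abs_pow, abs_pow, abs_neg, abs_neg,
      abs_of_pos (show 0 < t / 2 - k by linarith), abs_of_nonneg (show 0 ≤ t - m - k by linarith),
      show 2 * (k + 1) - 2 = 2 * k by omega, show m + 1 - (k + 1) = m - k by omega]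
    push_cast
    rw [abs_of_pos h1,
      show ((k : ℤ) + 1) - 2 * (m + 1) + 2 = ((k + 1 : ℕ) : ℤ) - ((2 * m : ℕ) : ℤ) by
        push_cast; ring, zpow_sub₀ h1.ne', zpow_natCast, zpow_natCast]
    generalize t / 2 - (k : ℝ) = y
    field_simp
    ring
  have hlow : 0 ≤ lowerCoeff (a ^ 2) t m := by
    rw [lowerCoeff]
    exact div_nonneg (mul_nonneg (by positivity) (by linarith)) (by linarith)
  have hrec : ∀ i ∈ Finset.range m, |recCoeff (a ^ 2) t i| ^ (i + 1) =
      recCoeff (a ^ 2) t i ^ (i + 1) := by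
    intro i hi
    have : (i : ℝ) + 1 ≤ m := by exact_mod_cast Finset.mem_range.1 hi
    rw [abs_of_nonneg]
    rw [recCoeff, lowerCoeff]
    exact div_nonneg (div_nonneg (mul_nonneg (by positivity) (by linarith)) (by linarith))
      (by linarith)
  rw [hg, hA, hB, abs_of_nonneg hlow, Finset.prod_congr rfl hrec] at hD
  rw [hA, Nat.add_sub_cancel]
  rw [ultraC] at hD
  rw [← hD] at hF
  generalize (∏ j ∈ Finset.range (m + 1), (t - m - j)) = A at *
  generalize (∏ j ∈ Finset.range (m + 1), (t / 2 - j)) = B at *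
  rw [show ∀ x y z w : ℝ, x * y * z * w = x * (y * z * w) from fun x y z w => by ring,
    ← hP] at hF
  rw [mul_assoc ((2 * a) ^ _), eq_div_iff (pow_ne_zero _ hA0.ne')]
  generalize ((m + 1).factorial : ℝ) ^ (2 * m) * _ = Y at *
  have e1 : (2 * a) ^ ((m + 1) * (m + 2)) = (2 * a) ^ ((m + 1) * 2) * (2 * a) ^ ((m + 1) * m) := by
    rw [← pow_add]; congr 1; ring
  have e2 : A ^ (2 * (m + 1)) = A ^ (2 * m) * A ^ 2 := by rw [← pow_add]; congr 1
  have hAne := hA0.ne'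
  rw [e1, e2, div_pow, mul_pow, ← pow_mul] at hF
  field_simp at hF
  exact hF

/-! ### Maximizing tuples on the real line -/

theorem norm_sub_mul_I_sq (a u : ℝ) : ‖(u : ℂ) - a * Complex.I‖ ^ 2 = u ^ 2 + a ^ 2 := by
  rw [← Complex.normSq_eq_norm_sq, Complex.normSq_apply]
  simp
  ring

theorem le_norm_sub_mul_I (a u : ℝ) : a ≤ ‖(u : ℂ) - a * Complex.I‖ :=
  (le_abs_self a).trans (abs_le_of_sq_le_sq (by rw [norm_sub_mul_I_sq]; nlinarith) (norm_nonneg _))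

theorem weight_pos {a : ℝ} (s : ℝ) (ha : 0 < a) (u : ℝ) : 0 < weight a s u :=
  Real.rpow_pos_of_pos (ha.trans_le (le_norm_sub_mul_I a u)) _

/-- The factor that a pair of real points contributes to the weighted Vandermonde product. -/
noncomputable def pairFactor (a s u v : ℝ) : ℝ := ‖(u : ℂ) - v‖ * weight a s u * weight a s v

/-- The product in the weighted Vandermonde functional, without the outer exponent, at a tuple of
real points. -/
noncomputable def pairProd (a s : ℝ) {n : ℕ} (x : Fin n → ℝ) : ℝ :=
  ∏ k, ∏ j ∈ Finset.Iio k, pairFactor a s (x j) (x k)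

theorem pairFactor_comm (a s u v : ℝ) : pairFactor a s u v = pairFactor a s v u := by
  rw [pairFactor, pairFactor, norm_sub_rev]; ring

theorem pairFactor_nonneg (a s u v : ℝ) : 0 ≤ pairFactor a s u v :=
  mul_nonneg (mul_nonneg (norm_nonneg _) (Real.rpow_nonneg (norm_nonneg _) _))
    (Real.rpow_nonneg (norm_nonneg _) _)

theorem pairFactor_pos {a : ℝ} (s : ℝ) (ha : 0 < a) {u v : ℝ} (h : u ≠ v) :
    0 < pairFactor a s u v :=
  mul_pos (mul_pos (norm_pos_iff.2 (sub_ne_zero.2 (by exact_mod_cast h))) (weight_pos s ha u))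
    (weight_pos s ha v)

/-- The estimate behind the existence of a maximum: `|u - v| ≤ |u - a i| |v - a i| / a`, and the
exponents `1 - s` are negative. -/
theorem pairFactor_le {a s : ℝ} (ha : 0 < a) (hs : 1 < s) (u v : ℝ) :
    pairFactor a s u v ≤ a⁻¹ * a ^ (1 - s) * ‖(v : ℂ) - a * Complex.I‖ ^ (1 - s) := by
  have hu := le_norm_sub_mul_I a u
  have hv := le_norm_sub_mul_I a v
  have hu2 := norm_sub_mul_I_sq a u
  have hv2 := norm_sub_mul_I_sq a v
  rw [pairFactor, weight, weight, ← Complex.ofReal_sub, Complex.norm_real, Real.norm_eq_abs]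
  set U := ‖(u : ℂ) - a * Complex.I‖
  set V := ‖(v : ℂ) - a * Complex.I‖
  have hU : 0 < U := ha.trans_le hu
  have hV : 0 < V := ha.trans_le hv
  have h1 : |u - v| ≤ a⁻¹ * (U * V) := by
    rw [le_inv_mul_iff₀ ha]
    refine (sq_le_sq₀ (by positivity) (by positivity)).1 ?_
    rw [mul_pow, mul_pow, sq_abs, hu2, hv2]
    nlinarith [sq_nonneg (u * v + a ^ 2)]
  have h2 : ∀ W : ℝ, 0 < W → W * W ^ (-s) = W ^ (1 - s) := fun W hW => by
    rw [sub_eq_add_neg, Real.rpow_add hW, Real.rpow_one]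
  calc |u - v| * U ^ (-s) * V ^ (-s) ≤ a⁻¹ * (U * V) * U ^ (-s) * V ^ (-s) := by gcongr
    _ = a⁻¹ * U ^ (1 - s) * V ^ (1 - s) := by rw [← h2 U hU, ← h2 V hV]; ring
    _ ≤ _ := by
      have := Real.rpow_le_rpow_of_nonpos ha hu (show 1 - s ≤ 0 by linarith)
      gcongr

theorem pairProd_nonneg (a s : ℝ) {n : ℕ} (x : Fin n → ℝ) : 0 ≤ pairProd a s x :=
  Finset.prod_nonneg fun _ _ => Finset.prod_nonneg fun _ _ => pairFactor_nonneg _ _ _ _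

theorem pairProd_pos {a : ℝ} (s : ℝ) (ha : 0 < a) {n : ℕ} {x : Fin n → ℝ}
    (hx : Function.Injective x) : 0 < pairProd a s x :=
  Finset.prod_pos fun _ _ => Finset.prod_pos fun _ hj =>
    pairFactor_pos s ha (hx.ne (Finset.mem_Iio.1 hj).ne)

theorem injective_of_pairProd_ne_zero {a s : ℝ} {n : ℕ} {x : Fin n → ℝ} (h : pairProd a s x ≠ 0) :
    Function.Injective x := by
  have key : ∀ j k, j < k → x j ≠ x k := by
    intro j k hjk he
    refine h (Finset.prod_eq_zero (Finset.mem_univ k)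
      (Finset.prod_eq_zero (Finset.mem_Iio.2 hjk) ?_))
    simp [pairFactor, he]
  intro j k he
  by_contra hne
  rcases lt_or_gt_of_ne hne with hlt | hlt
  · exact key _ _ hlt he
  · exact key _ _ hlt he.symm

theorem pairProd_sq (a s : ℝ) {n : ℕ} (x : Fin n → ℝ) :
    pairProd a s x ^ 2 = ∏ k, ∏ j ∈ {k}ᶜ, pairFactor a s (x j) (x k) := by
  rw [← Finset.prod_prod_Ioi_mul_eq_prod_prod_off_diag (fun j k => pairFactor a s (x j) (x k))]
  have h : pairProd a s x = ∏ j, ∏ k ∈ Finset.Ioi j, pairFactor a s (x j) (x k) := by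
    rw [pairProd]
    exact Finset.prod_comm' (by simp)
  simp only [Finset.prod_mul_distrib]
  rw [← h, sq]
  congr 1
  rw [h]
  simp only [pairFactor_comm]

/-- The dependence of the squared product on the point of index `i`. -/
theorem pairProd_sq_eq_mul (a s : ℝ) {n : ℕ} (x : Fin n → ℝ) (i : Fin n) :
    pairProd a s x ^ 2 = (∏ j ∈ {i}ᶜ, pairFactor a s (x j) (x i)) ^ 2 *
      ∏ k ∈ {i}ᶜ, ∏ j ∈ ({k}ᶜ : Finset (Fin n)).erase i, pairFactor a s (x j) (x k) := by
  rw [pairProd_sq, Fintype.prod_eq_mul_prod_compl i, sq, mul_assoc]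
  congr 1
  rw [← Finset.prod_mul_distrib]
  refine Finset.prod_congr rfl fun k hk => ?_
  rw [pairFactor_comm, Finset.mul_prod_erase _ (fun j => pairFactor a s (x j) (x k))]
  simpa [eq_comm] using hk

theorem continuous_pairProd {a : ℝ} (s : ℝ) (ha : 0 < a) (n : ℕ) :
    Continuous fun x : Fin n → ℝ => pairProd a s x := by
  have hw : Continuous fun u : ℝ => weight a s u := by
    refine Continuous.rpow_const (by fun_prop) fun u => Or.inl ?_
    exact (ha.trans_le (le_norm_sub_mul_I a u)).ne'
  refine continuous_finsetProd Finset.univ fun k _ =>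
    continuous_finsetProd (Finset.Iio k) fun j _ => ?_
  exact ((by fun_prop : Continuous fun x : Fin n → ℝ => ‖((x j : ℝ) : ℂ) - (x k : ℝ)‖).mul
    (hw.comp (continuous_apply j))).mul (hw.comp (continuous_apply k))

/-- The functional attains its maximum: it tends to zero when one of the points tends to infinity,
because `|u - v| ≤ |u - a i| |v - a i| / a` and `s > 1`. -/
theorem exists_forall_pairProd_le {a s : ℝ} {n : ℕ} (ha : 0 < a) (hs : 1 < s) (hn : 2 ≤ n) :
    ∃ x : Fin n → ℝ, ∀ y : Fin n → ℝ, pairProd a s y ≤ pairProd a s x := by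
  -- Any tuple of distinct points has a positive product, which the values near infinity stay below.
  set x₀ : Fin n → ℝ := fun k => (k : ℕ) with hx₀
  have hinj : Function.Injective x₀ := fun j k h => Fin.ext (by simpa [hx₀] using h)
  have hpos := pairProd_pos s ha hinj
  refine (continuous_pairProd s ha n).exists_forall_ge' x₀ ?_
  set K : ℝ := a⁻¹ * a ^ (1 - s) with hK
  have hK0 : 0 < K := by positivity
  set M : ℝ := (K * a ^ (1 - s)) ^ (n - 1) with hM
  have hfM : ∀ u v, pairFactor a s u v ≤ K * a ^ (1 - s) := fun u v =>
    (pairFactor_le ha hs u v).trans <| mul_le_mul_of_nonneg_left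
      (Real.rpow_le_rpow_of_nonpos ha (le_norm_sub_mul_I a v) (by linarith)) hK0.le
  have hcard : ∀ k : Fin n, ({k}ᶜ : Finset (Fin n)).card = n - 1 := fun k => by
    rw [Finset.card_compl, Fintype.card_fin, Finset.card_singleton]
  have hlim : Filter.Tendsto (fun r : ℝ => (K * r ^ (1 - s)) ^ (n - 1) * M ^ (n - 1)) Filter.atTop
      (nhds 0) := by
    have h1 : Filter.Tendsto (fun r : ℝ => r ^ (1 - s)) Filter.atTop (nhds 0) := by
      rw [show 1 - s = -(s - 1) by ring]
      exact tendsto_rpow_neg_atTop (by linarith)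
    have h2 := ((h1.const_mul K).pow (n - 1)).mul_const (M ^ (n - 1))
    rwa [mul_zero, zero_pow (by omega), zero_mul] at h2
  obtain ⟨R, hR⟩ := Filter.eventually_atTop.1
    (hlim.eventually (gt_mem_nhds (show 0 < pairProd a s x₀ ^ 2 by positivity)))
  have hev : ∀ᶠ x : Fin n → ℝ in Filter.cocompact _, max R 1 < ‖x‖ :=
    tendsto_norm_cocompact_atTop.eventually_gt_atTop _
  filter_upwards [hev] with x hx
  obtain ⟨i, hi⟩ : ∃ i, max R 1 < ‖x i‖ := by
    by_contra! hcon
    exact absurd ((pi_norm_le_iff_of_nonneg (le_max_of_le_right zero_le_one)).2 hcon) (not_le.2 hx)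
  rw [Real.norm_eq_abs] at hi
  refine (sq_le_sq₀ (pairProd_nonneg _ _ _) hpos.le).1 ?_
  refine le_trans ?_ (hR |x i| ((le_max_left _ _).trans hi.le)).le
  -- The row of the large coordinate `x i` is small, and the other rows are bounded.
  rw [pairProd_sq, Fintype.prod_eq_mul_prod_compl i]
  have hxi : 0 < |x i| := zero_lt_one.trans_le ((le_max_right _ _).trans hi.le)
  have hNx : |x i| ≤ ‖((x i : ℝ) : ℂ) - a * Complex.I‖ := by
    refine abs_le_of_sq_le_sq ?_ (norm_nonneg _)
    rw [norm_sub_mul_I_sq]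
    nlinarith
  refine mul_le_mul ?_ ?_ ?_ (by positivity)
  · refine (Finset.prod_le_prod (fun _ _ => pairFactor_nonneg _ _ _ _) fun j _ =>
      (pairFactor_le ha hs (x j) (x i)).trans (mul_le_mul_of_nonneg_left
      (Real.rpow_le_rpow_of_nonpos hxi hNx (by linarith)) hK0.le)).trans_eq ?_
    rw [Finset.prod_const, hcard]
  · refine (Finset.prod_le_prod (fun _ _ => Finset.prod_nonneg fun _ _ =>
      pairFactor_nonneg _ _ _ _) fun k _ => Finset.prod_le_prod
      (fun _ _ => pairFactor_nonneg _ _ _ _) fun j _ => hfM (x j) (x k)).trans_eq ?_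
    simp only [Finset.prod_const, hcard, hM]
  · exact Finset.prod_nonneg fun _ _ => Finset.prod_nonneg fun _ _ => pairFactor_nonneg _ _ _ _

theorem pairProd_pos_of_forall_le {a s : ℝ} {n : ℕ} (ha : 0 < a) {x : Fin n → ℝ}
    (hx : ∀ y : Fin n → ℝ, pairProd a s y ≤ pairProd a s x) : 0 < pairProd a s x := by
  have hinj : Function.Injective (fun k : Fin n => ((k : ℕ) : ℝ)) :=
    fun j k h => Fin.ext (by simpa using h)
  exact (pairProd_pos s ha hinj).trans_le (hx _)

/-- At a maximizing tuple each point maximizes, with the other points fixed, the product of its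
distances to them times a power of its weight. -/
theorem eval_sq_mul_rpow_le {a s : ℝ} {n : ℕ} (ha : 0 < a) (hn : 2 ≤ n) {x : Fin n → ℝ}
    (hx : ∀ y : Fin n → ℝ, pairProd a s y ≤ pairProd a s x) (i : Fin n) (y : ℝ) :
    (∏ j ∈ {i}ᶜ, (X - C (x j))).eval y ^ 2 * (y ^ 2 + a ^ 2) ^ (-(s * ((n : ℝ) - 1))) ≤
      (∏ j ∈ {i}ᶜ, (X - C (x j))).eval (x i) ^ 2 *
        (x i ^ 2 + a ^ 2) ^ (-(s * ((n : ℝ) - 1))) := by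
  have hrow : ∀ u : ℝ, (∏ j ∈ {i}ᶜ, pairFactor a s (x j) u) ^ 2 =
      (∏ j ∈ {i}ᶜ, weight a s (x j)) ^ 2 * ((∏ j ∈ {i}ᶜ, (X - C (x j))).eval u ^ 2 *
        (u ^ 2 + a ^ 2) ^ (-(s * ((n : ℝ) - 1)))) := by
    intro u
    have hw : (weight a s u ^ (n - 1)) ^ 2 = (u ^ 2 + a ^ 2) ^ (-(s * ((n : ℝ) - 1))) := by
      rw [weight, ← norm_sub_mul_I_sq, ← Real.rpow_natCast, ← Real.rpow_natCast,
        ← Real.rpow_natCast, ← Real.rpow_mul (norm_nonneg _), ← Real.rpow_mul (norm_nonneg _),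
        ← Real.rpow_mul (norm_nonneg _), Nat.cast_sub (by omega)]
      congr 1
      push_cast
      ring
    rw [← hw]
    simp only [pairFactor, Finset.prod_mul_distrib, Finset.prod_const, eval_prod, eval_sub, eval_X,
      eval_C, ← Complex.ofReal_sub, Complex.norm_real, Real.norm_eq_abs, Finset.card_compl,
      Fintype.card_fin, Finset.card_singleton]
    rw [← Finset.abs_prod, mul_pow, mul_pow, sq_abs, ← Finset.prod_pow, ← Finset.prod_pow,
      ← Finset.prod_pow]
    rw [Finset.prod_congr rfl fun j _ => show (x j - u) ^ 2 = (u - x j) ^ 2 by ring]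
    ring
  set R := ∏ k ∈ {i}ᶜ, ∏ j ∈ ({k}ᶜ : Finset (Fin n)).erase i, pairFactor a s (x j) (x k) with hRdef
  have hpos := pairProd_pos_of_forall_le ha hx
  have h1 := pairProd_sq_eq_mul a s x i
  have h2 := pairProd_sq_eq_mul a s (Function.update x i y) i
  have hrest : ∏ k ∈ {i}ᶜ, ∏ j ∈ ({k}ᶜ : Finset (Fin n)).erase i,
      pairFactor a s (Function.update x i y j) (Function.update x i y k) = R := by
    refine Finset.prod_congr rfl fun k hk => Finset.prod_congr rfl fun j hj => ?_
    have hki : k ≠ i := by simpa using hk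
    rw [Function.update_of_ne hki, Function.update_of_ne (Finset.ne_of_mem_erase hj)]
  have hfirst : ∏ j ∈ {i}ᶜ,
      pairFactor a s (Function.update x i y j) (Function.update x i y i) =
      ∏ j ∈ {i}ᶜ, pairFactor a s (x j) y := by
    refine Finset.prod_congr rfl fun j hj => ?_
    have hji : j ≠ i := by simpa using hj
    rw [Function.update_of_ne hji, Function.update_self]
  rw [hrest, hfirst, hrow] at h2
  rw [← hRdef, hrow] at h1
  have hle := pow_le_pow_left₀ (pairProd_nonneg a s _) (hx (Function.update x i y)) 2
  rw [h1, h2] at hle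
  have hR0 : 0 < R := by
    have hR' : 0 ≤ R :=
      Finset.prod_nonneg fun _ _ => Finset.prod_nonneg fun _ _ => pairFactor_nonneg _ _ _ _
    refine lt_of_le_of_ne hR' fun h0 => ?_
    rw [← h0, mul_zero] at h1
    exact (pow_pos hpos 2).ne' h1
  have hW0 : 0 < (∏ j ∈ {i}ᶜ, weight a s (x j)) ^ 2 :=
    pow_pos (Finset.prod_pos fun j _ => weight_pos s ha (x j)) 2
  exact le_of_mul_le_mul_left (le_of_mul_le_mul_right hle hR0) hW0

/-- Fermat's rule for `p² (y² + a²) ^ (-T)`; squaring `p` avoids the absolute value. -/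
theorem stationary_of_forall_le {a T : ℝ} (ha : 0 < a) {p : ℝ[X]} {u : ℝ} (hp : p.eval u ≠ 0)
    (h : ∀ y, p.eval y ^ 2 * (y ^ 2 + a ^ 2) ^ (-T) ≤ p.eval u ^ 2 * (u ^ 2 + a ^ 2) ^ (-T)) :
    (u ^ 2 + a ^ 2) * (derivative p).eval u = T * u * p.eval u := by
  have hq : 0 < u ^ 2 + a ^ 2 := by positivity
  have hmax : IsLocalMax (fun y : ℝ => p.eval y ^ 2 * (y ^ 2 + a ^ 2) ^ (-T)) u :=
    Filter.Eventually.of_forall h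
  have hd1 : HasDerivAt (fun y : ℝ => p.eval y ^ 2) (2 * p.eval u * (derivative p).eval u) u := by
    simpa using (p.hasDerivAt u).fun_pow 2
  have hd2 : HasDerivAt (fun y : ℝ => y ^ 2 + a ^ 2) (2 * u) u := by
    simpa using ((hasDerivAt_id' u).fun_pow 2).add_const (a ^ 2)
  have hd := hd1.mul (hd2.rpow_const (p := -T) (Or.inl hq.ne'))
  have h0 := hmax.hasDerivAt_eq_zero hd
  have hr : (u ^ 2 + a ^ 2) ^ (-T) = (u ^ 2 + a ^ 2) ^ (-T - 1) * (u ^ 2 + a ^ 2) := by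
    rw [← Real.rpow_add_one hq.ne']; congr 1; ring
  have hr0 : (u ^ 2 + a ^ 2) ^ (-T - 1) ≠ 0 := (Real.rpow_pos_of_pos hq _).ne'
  rw [hr] at h0
  refine mul_left_cancel₀ (mul_ne_zero (mul_ne_zero two_ne_zero hp) hr0) ?_
  linear_combination h0

/-- The points of a maximizing tuple are the roots of `feketePoly`: by stationarity the differential
operator sends their monic polynomial to a polynomial of degree less than `n` that vanishes at these
`n` points. -/
theorem prod_X_sub_C_eq_feketePoly {a s : ℝ} {n : ℕ} (ha : 0 < a) (hs : 1 < s) (hn : 2 ≤ n)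
    {x : Fin n → ℝ} (hx : ∀ y : Fin n → ℝ, pairProd a s y ≤ pairProd a s x) :
    ∏ j, (X - C (x j)) = feketePoly a s n := by
  have hinj := injective_of_pairProd_ne_zero (pairProd_pos_of_forall_le ha hx).ne'
  set Q : ℝ[X] := ∏ j, (X - C (x j)) with hQ
  have hQm : Q.Monic := monic_prod_X_sub_C _ _
  have hQd : Q.natDegree = n := by
    rw [hQ, natDegree_finsetProd_X_sub_C_eq_card]; simp
  have hQc : Q.coeff n = 1 := by rw [← hQd]; exact hQm.coeff_natDegree
  have hGc := (feketePoly_monic a s n).coeff_natDegree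
  rw [feketePoly_natDegree] at hGc
  set t : ℝ := 2 * s * ((n : ℝ) - 1) with ht
  have h2n : (2 : ℝ) ≤ n := by exact_mod_cast hn
  have hode : odeOp (a ^ 2) t n Q = 0 := by
    refine eq_zero_of_natDegree_lt_card_of_eval_eq_zero _ hinj (fun i => ?_) ?_
    · have hfac : Q = (X - C (x i)) * ∏ j ∈ {i}ᶜ, (X - C (x j)) :=
        Fintype.prod_eq_mul_prod_compl i _
      have hne : (∏ j ∈ {i}ᶜ, (X - C (x j))).eval (x i) ≠ 0 := by
        rw [eval_prod, Finset.prod_ne_zero_iff]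
        intro j hj
        have hji : j ≠ i := by simpa using hj
        simpa [sub_eq_zero] using hinj.ne hji.symm
      have hst := stationary_of_forall_le ha hne (eval_sq_mul_rpow_le ha hn hx i)
      rw [hfac, odeOp]
      simp only [derivative_mul, derivative_add, derivative_sub, derivative_X, derivative_C,
        eval_add, eval_sub, eval_mul, eval_pow, eval_X, eval_C, derivative_one, eval_one, eval_zero]
      simp only [sub_self, sub_zero, one_mul, zero_mul, add_zero, zero_add, mul_zero,
        derivative_zero, eval_zero]
      linear_combination 2 * hst
    · rw [Fintype.card_fin]
      refine lt_of_le_of_ne (natDegree_odeOp_le _ _ _ hQd.le) fun he => ?_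
      have hc := coeff_odeOp (a ^ 2) t n Q n
      rw [coeff_eq_zero_of_natDegree_lt (by omega : Q.natDegree < n + 2), sub_self, zero_mul,
        zero_mul, mul_zero, zero_add] at hc
      have h0 : odeOp (a ^ 2) t n Q = 0 := by
        rw [← leadingCoeff_eq_zero, leadingCoeff, he, hc]
      rw [h0, natDegree_zero] at he
      omega
  refine eq_of_odeOp_eq_zero ?_ hQd.le (feketePoly_natDegree _ _ _).le hode
    (odeOp_feketePoly hs hn) (by rw [hQc, hGc])
  intro m hm
  have hm' : (m : ℝ) + 1 ≤ n := by exact_mod_cast hm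
  apply ne_of_gt
  nlinarith

/-! ### The maximal value -/

theorem aeval_feketePoly_eq_prod {a s : ℝ} {n : ℕ} {x : Fin n → ℝ}
    (hG : ∏ j, (X - C (x j)) = feketePoly a s n) (z : ℂ) :
    aeval z (feketePoly a s n) = ∏ j, (z - x j) := by
  rw [← hG, map_prod]
  simp

theorem range_ofReal_eq_roots {a s : ℝ} {n : ℕ} {x : Fin n → ℝ}
    (hG : ∏ j, (X - C (x j)) = feketePoly a s n) :
    Set.range (fun k => (x k : ℂ)) = {z : ℂ | aeval z (feketePoly a s n) = 0} := by
  ext z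
  rw [Set.mem_ofPred_eq, aeval_feketePoly_eq_prod hG, Finset.prod_eq_zero_iff]
  simp [sub_eq_zero, eq_comm]

/-- The squared maximum is the discriminant of `feketePoly` times a power of its value at `a i`. -/
theorem pairProd_sq_eq_rootProd {a s : ℝ} {n : ℕ} {x : Fin n → ℝ}
    (hG : ∏ j, (X - C (x j)) = feketePoly a s n) :
    pairProd a s x ^ 2 = rootProd ((feketePoly a s n).map (algebraMap ℝ ℂ))
        (derivative ((feketePoly a s n).map (algebraMap ℝ ℂ))) *
      (‖aeval ((a : ℂ) * Complex.I) (feketePoly a s n)‖ ^ (-s)) ^ (2 * (n - 1)) := by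
  have hmap : (feketePoly a s n).map (algebraMap ℝ ℂ) = ∏ j, (X - C (x j : ℂ)) := by
    rw [← hG, Polynomial.map_prod]
    simp
  have hroots : ((feketePoly a s n).map (algebraMap ℝ ℂ)).roots =
      (Finset.univ : Finset (Fin n)).val.map fun j => (x j : ℂ) := by
    rw [hmap, ← roots_multiset_prod_X_sub_C (Multiset.map (fun j => (x j : ℂ)) _),
      Multiset.map_map]
    rfl
  have hder : ∀ k, eval (x k : ℂ) (derivative ((feketePoly a s n).map (algebraMap ℝ ℂ))) =
      ∏ j ∈ {k}ᶜ, ((x k : ℂ) - x j) := by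
    intro k
    rw [hmap, Fintype.prod_eq_mul_prod_compl k, derivative_mul]
    simp [eval_prod]
  have hdisc : rootProd ((feketePoly a s n).map (algebraMap ℝ ℂ))
      (derivative ((feketePoly a s n).map (algebraMap ℝ ℂ))) =
      ∏ k, ∏ j ∈ {k}ᶜ, ‖(x j : ℂ) - x k‖ := by
    rw [rootProd, hroots, Multiset.map_map, ← Finset.prod_eq_multiset_prod]
    refine Finset.prod_congr rfl fun k _ => ?_
    rw [Function.comp_apply, hder, norm_prod]
    exact Finset.prod_congr rfl fun j _ => norm_sub_rev _ _
  have hg : ‖aeval ((a : ℂ) * Complex.I) (feketePoly a s n)‖ ^ (-s) = ∏ k, weight a s (x k) := by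
    rw [aeval_feketePoly_eq_prod hG, norm_prod, ← Real.finsetProd_rpow _ _ fun _ _ => norm_nonneg _]
    exact Finset.prod_congr rfl fun k _ => by rw [weight, norm_sub_rev]
  have hcard : ∀ k : Fin n, ({k}ᶜ : Finset (Fin n)).card = n - 1 := fun k => by
    rw [Finset.card_compl, Fintype.card_fin, Finset.card_singleton]
  have hw1 : ∏ k, ∏ _j ∈ ({k}ᶜ : Finset (Fin n)), weight a s (x k) =
      (∏ k, weight a s (x k)) ^ (n - 1) := by
    simp only [Finset.prod_const, hcard, Finset.prod_pow]
  have hw2 : ∏ k, ∏ j ∈ ({k}ᶜ : Finset (Fin n)), weight a s (x j) =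
      (∏ k, weight a s (x k)) ^ (n - 1) := by
    rw [← hw1]
    exact Finset.prod_comm' (by simp [eq_comm])
  rw [pairProd_sq, hdisc, hg]
  simp only [pairFactor, Finset.prod_mul_distrib]
  rw [hw1, hw2]
  ring

/-- The maximal value of the functional agrees with the closed form. -/
theorem pairProd_rpow_eq_diameterFormula {a s : ℝ} {n : ℕ} (ha : 0 < a) (hs : 1 < s) (hn : 2 ≤ n)
    {x : Fin n → ℝ} (hG : ∏ j, (X - C (x j)) = feketePoly a s n) :
    pairProd a s x ^ (2 / ((n : ℝ) * ((n : ℝ) - 1))) = diameterFormula a s n := by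
  have h2n : (2 : ℝ) ≤ n := by exact_mod_cast hn
  have hn0 : (n : ℝ) ≠ 0 := by linarith
  have hn1 : (n : ℝ) - 1 ≠ 0 := by linarith
  have hsq : pairProd a s x ^ (2 / ((n : ℝ) * ((n : ℝ) - 1))) =
      (pairProd a s x ^ 2) ^ (1 / ((n : ℝ) * ((n : ℝ) - 1))) := by
    rw [← Real.rpow_natCast, ← Real.rpow_mul (pairProd_nonneg a s x)]
    congr 1
    push_cast
    ring
  rw [hsq, pairProd_sq_eq_rootProd hG, rootProd_derivative_feketePoly ha hs hn,
    norm_aeval_feketePoly_mul_I ha hs hn, diameterFormula]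
  have hA0 : 0 < |poch ((n : ℝ) - 2 * s * ((n : ℝ) - 1) - 1) n| := by
    rw [abs_pos, poch_eq_prod, Finset.prod_ne_zero_iff]
    intro j hj
    have : (j : ℝ) + 1 ≤ n := by exact_mod_cast Finset.mem_range.1 hj
    apply ne_of_lt
    nlinarith
  have hB0 : 0 < |poch (-s * ((n : ℝ) - 1)) n| := by
    rw [abs_pos, poch_eq_prod, Finset.prod_ne_zero_iff]
    intro j hj
    have : (j : ℝ) + 1 ≤ n := by exact_mod_cast Finset.mem_range.1 hj
    apply ne_of_lt
    nlinarith
  have hF0 : (0 : ℝ) < n.factorial := by exact_mod_cast n.factorial_pos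
  generalize |poch ((n : ℝ) - 2 * s * ((n : ℝ) - 1) - 1) n| = A at *
  generalize |poch (-s * ((n : ℝ) - 1)) n| = B at *
  generalize (n.factorial : ℝ) = F at *
  have hP0 := abs_nonneg (∏ k ∈ Finset.Icc 1 n, (k : ℝ) ^ ((k : ℤ) - 2 * (n : ℤ) + 2) *
        ((k : ℝ) - s * ((n : ℝ) - 1) - 1) ^ (2 * k - 2) *
        ((n : ℝ) + k - 2 * s * ((n : ℝ) - 1) - 2) ^ (n - k))
  generalize |∏ k ∈ Finset.Icc 1 n, (k : ℝ) ^ ((k : ℤ) - 2 * (n : ℤ) + 2) *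
        ((k : ℝ) - s * ((n : ℝ) - 1) - 1) ^ (2 * k - 2) *
        ((n : ℝ) + k - 2 * s * ((n : ℝ) - 1) - 2) ^ (n - k)| = P at *
  have h2a : 0 < 2 * a := by linarith
  generalize 2 * a = α at *
  clear hG hsq
  have hcast : ((n - 1 : ℕ) : ℝ) = n - 1 := by
    rw [Nat.cast_sub (by omega)]; simp
  -- Each positive base is written as an exponential of its logarithm, to compare exponents.
  obtain ⟨lA, rfl⟩ : ∃ l, A = Real.exp l := ⟨_, (Real.exp_log hA0).symm⟩
  obtain ⟨lB, rfl⟩ : ∃ l, B = Real.exp l := ⟨_, (Real.exp_log hB0).symm⟩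
  obtain ⟨lF, rfl⟩ : ∃ l, F = Real.exp l := ⟨_, (Real.exp_log hF0).symm⟩
  obtain ⟨lα, rfl⟩ : ∃ l, α = Real.exp l := ⟨_, (Real.exp_log h2a).symm⟩
  simp only [← Real.exp_nat_mul, ← Real.exp_mul, ← Real.exp_add, ← Real.exp_sub]
  rw [show ∀ u v w : ℝ, Real.exp u * P / Real.exp v * Real.exp w = P * Real.exp (u - v + w) from
    fun u v w => by
      rw [Real.exp_add, Real.exp_sub]; ring]
  rw [Real.mul_rpow hP0 (Real.exp_pos _).le, ← Real.exp_mul, mul_comm]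
  congr 2
  push_cast [hcast]
  field_simp
  ring

/-- A tuple of points of the real line is a tuple of real numbers. -/
theorem exists_eq_ofReal {n : ℕ} {z : Fin n → ℂ} (hz : ∀ k, z k ∈ realLine) :
    ∃ x : Fin n → ℝ, z = fun k => (x k : ℂ) := by
  choose x hx using hz
  exact ⟨x, funext fun k => (hx k).symm⟩

theorem weightedVandermonde_ofReal (a s : ℝ) {n : ℕ} (x : Fin n → ℝ) :
    weightedVandermonde n (weight a s) (fun k => (x k : ℂ)) =
      pairProd a s x ^ (2 / ((n : ℝ) * ((n : ℝ) - 1))) := rfl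

theorem weightedVandermonde_le_iff {a s : ℝ} {n : ℕ} (hn : 2 ≤ n) (x y : Fin n → ℝ) :
    weightedVandermonde n (weight a s) (fun k => (y k : ℂ)) ≤
      weightedVandermonde n (weight a s) (fun k => (x k : ℂ)) ↔ pairProd a s y ≤ pairProd a s x := by
  have h2n : (2 : ℝ) ≤ n := by exact_mod_cast hn
  rw [weightedVandermonde_ofReal, weightedVandermonde_ofReal]
  exact Real.rpow_le_rpow_iff (pairProd_nonneg _ _ _) (pairProd_nonneg _ _ _)
    (div_pos two_pos (mul_pos (by linarith) (by linarith)))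

end WeightedFekete

theorem theorem1p2 (a s : ℝ) (n : ℕ) (ha : 0 < a) (hs : 1 < s) (hn : 2 ≤ n) :
    -- there is exactly one weighted Fekete set, the set of (complex) roots of `G`
    (∀ F : Set ℂ,
      WeightedFekete.IsWeightedFeketeSet n (WeightedFekete.weight a s) WeightedFekete.realLine F ↔
        F = {z : ℂ | Polynomial.aeval z (WeightedFekete.feketePoly a s n) = 0}) ∧
    -- `G` is a rescaled Jacobi polynomial
    (∀ x : ℂ, Polynomial.aeval x (WeightedFekete.feketePoly a s n) =
      (2 * a * Complex.I) ^ n * (n.factorial : ℂ) /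
          WeightedFekete.poch ((n : ℂ) - 2 * s * ((n : ℂ) - 1) - 1) n *
        (WeightedFekete.jacobi n (-s * ((n : ℂ) - 1) - 1) (-s * ((n : ℂ) - 1) - 1)).eval
          (-Complex.I * x / a)) ∧
    -- the weighted diameter is a genuine supremum, with the explicit value
    BddAbove (WeightedFekete.vandermondeValues n (WeightedFekete.weight a s)
      WeightedFekete.realLine) ∧
    WeightedFekete.weightedDiameter n (WeightedFekete.weight a s) WeightedFekete.realLine =
      WeightedFekete.diameterFormula a s n := by
  open WeightedFekete in
  obtain ⟨x, hx⟩ := exists_forall_pairProd_le ha hs hn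
  have hG := prod_X_sub_C_eq_feketePoly ha hs hn hx
  have hgreatest : IsGreatest (vandermondeValues n (weight a s) realLine)
      (diameterFormula a s n) := by
    rw [← pairProd_rpow_eq_diameterFormula ha hs hn hG, ← weightedVandermonde_ofReal]
    refine ⟨⟨_, fun k => ⟨x k, rfl⟩, rfl⟩, ?_⟩
    rintro v ⟨z, hz, rfl⟩
    obtain ⟨y, rfl⟩ := exists_eq_ofReal hz
    exact (weightedVandermonde_le_iff hn x y).2 (hx y)
  refine ⟨fun F => ⟨?_, ?_⟩, fun z => aeval_feketePoly_eq_jacobi ha hs hn z, hgreatest.bddAbove,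
    hgreatest.csSup_eq⟩
  · rintro ⟨z, -, rfl, hz, hmax⟩
    obtain ⟨y, rfl⟩ := exists_eq_ofReal hz
    refine range_ofReal_eq_roots (prod_X_sub_C_eq_feketePoly ha hs hn fun u => ?_)
    exact (weightedVandermonde_le_iff hn y u).1 (hmax _ fun k => ⟨u k, rfl⟩)
  · rintro rfl
    refine ⟨fun k => (x k : ℂ), Complex.ofReal_injective.comp
      (injective_of_pairProd_ne_zero (pairProd_pos_of_forall_le ha hx).ne'),
      range_ofReal_eq_roots hG, fun k => ⟨x k, rfl⟩, fun z hz => ?_⟩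
    obtain ⟨y, rfl⟩ := exists_eq_ofReal hz
    exact (weightedVandermonde_le_iff hn x y).2 (hx y)
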